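/- Let $n\ge 1$, let $\mathbb F_n^+$ be the free monoid on generators $g_1,\dots,g_n$, and let $\mathcal H$ be an infinite-dimensional complex Hilbert space. For an $n$-tuple $X=(X_1,\dots,X_n)$ and $\alpha=g_{i_1}\cdots g_{i_k}$ write $|\alpha|=k$ and $X_\alpha=X_{i_1}\cdots X_{i_k}$ (the identity if $k=0$). Let $$[B(\mathcal H)^n]_1=\{X\in B(\mathcal H)^n:\ \|X_1X_1^*+\cdots+X_nX_n^*\|^{1/2}<1\},$$ and let $\mathbb B_n$ be the open Euclidean unit ball of $\mathbb C^n$. A free holomorphic function is a formal power series $f=\sum_{\alpha\in\mathbb F_n^+}a_\alpha Z_\alpha$ with $a_\alpha\in\mathbb C$ and $\limsup_{k\to\infty}\big(\sum_{|\alpha|=k}|a_\alpha|^2\big)^{1/2k}\le 1$; it is evaluated at $X\in[B(\mathcal H)^n]_1$ by the norm convergent series $f(X)=\sum_{k=0}^\infty\sum_{|\alpha|=k}a_\alpha X_\alpha$, and in the same way at $\lambda\in\mathbb B_n$, which gives $f(\lambda)\in\mathbb C$. The noncommutative Hardy space $H^2_{\bf ball}$ is the Hilbert space of all such $f$ with $\|f\|^2:=\sum_\alpha|a_\alpha|^2<\infty$.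 A free holomorphic self-map of $[B(\mathcal H)^n]_1$ is an $n$-tuple $\varphi=(\varphi_1,\dots,\varphi_n)$ of free holomorphic functions such that $\varphi(X)=(\varphi_1(X),\dots,\varphi_n(X))\in[B(\mathcal H)^n]_1$ for every $X\in[B(\mathcal H)^n]_1$. For $\lambda\in\mathbb B_n$, $\varphi(\lambda)=(\varphi_1(\lambda),\dots,\varphi_n(\lambda))\in\mathbb C^n$ and $\|\varphi(\lambda)\|$ is its Euclidean norm. Let $\varphi$ be a free holomorphic self-map of $[B(\mathcal H)^n]_1$. Then the composition operator $C_\varphi f:=f\circ\varphi$ is a well-defined bounded operator on $H^2_{\bf ball}$: there is exactly one bounded linear operator $C_\varphi$ on $H^2_{\bf ball}$ such that $(C_\varphi f)(X)=f(\varphi(X))$ for all $f\in H^2_{\bf ball}$ and all $X\in[B(\mathcal H)^n]_1$. Moreover, the supremum below is finite and $$\frac{1}{(1-\|\varphi(0)\|^2)^{1/2}}\ \le\ \sup_{\lambda\in\mathbb B_n}\left(\frac{1-\|\lambda\|^2}{1-\|\varphi(\lambda)\|^2}\right)^{1/2}\ \le\ \|C_\varphi\|\ \le\ \left(\frac{1+\|\varphi(0)\|}{1-\|\varphi(0)\|}\right)^{1/2}.$$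 -/

import Mathlib

open Filter Topology
open scoped ENNReal

noncomputable section

/-- The element `g_{i_1} ⋯ g_{i_k}` of the free monoid on `n` generators. -/
def word {n k : ℕ} (w : Fin k → Fin n) : FreeMonoid (Fin n) :=
  FreeMonoid.ofList (List.ofFn w)

/-- A free holomorphic function on the open operatorial `n`-ball of radius one: a noncommutative
power series `∑ a_α Z_α` with complex coefficients indexed by the free monoid on `n` generators,
and radius of convergence at least one. -/
structure FreeHolomorphic (n : ℕ) where
  coeff : FreeMonoid (Fin n) → ℂ
  radius : limsup (fun k : ℕ => ENNReal.ofReal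
    ((∑ w : Fin k → Fin n, ‖coeff (word w)‖ ^ 2) ^ (1 / (2 * (k : ℝ))))) atTop ≤ 1

/-- The homogeneous part `∑_{|α| = k} a_α X_α`, where `X_α = X_{i_1} ⋯ X_{i_k}` for
`α = g_{i_1} ⋯ g_{i_k}`. -/
def FreeHolomorphic.homogeneousPart {n : ℕ} {A : Type*} [NormedRing A] [NormedAlgebra ℂ A]
    (f : FreeHolomorphic n) (k : ℕ) (X : Fin n → A) : A :=
  ∑ w : Fin k → Fin n, f.coeff (word w) • FreeMonoid.lift X (word w)

/-- The value `f(X) = ∑_{k ≥ 0} ∑_{|α| = k} a_α X_α`, the series converging in norm. Used with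
`A = B(H)` (the representation of `f` on `H`) and with `A = ℂ` (the scalar representation). -/
def FreeHolomorphic.eval {n : ℕ} {A : Type*} [NormedRing A] [NormedAlgebra ℂ A]
    (f : FreeHolomorphic n) (X : Fin n → A) : A :=
  ∑' k : ℕ, f.homogeneousPart k X

/-- The noncommutative open unit ball `[B(H)^n]_1`: the `n`-tuples `(X_1, …, X_n)` of bounded
operators on `H` with `‖X_1 X_1^* + ⋯ + X_n X_n^*‖^{1/2} < 1`. -/
def ncBall (n : ℕ) (H : Type*) [NormedAddCommGroup H] [InnerProductSpace ℂ H] [CompleteSpace H] :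
    Set (Fin n → (H →L[ℂ] H)) :=
  {X | √‖∑ i, X i * ContinuousLinearMap.adjoint (X i)‖ < 1}

/-- An `n`-tuple of free holomorphic functions is a self-map of `[B(H)^n]_1`. -/
def IsFreeHolomorphicSelfMap {n : ℕ} (H : Type*) [NormedAddCommGroup H] [InnerProductSpace ℂ H]
    [CompleteSpace H] (φ : Fin n → FreeHolomorphic n) : Prop :=
  ∀ X ∈ ncBall n H, (fun i => (φ i).eval X) ∈ ncBall n H

/-- The scalar representation `λ ↦ φ(λ) = (φ_1(λ), …, φ_n(λ))`, with values in Euclidean space. -/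
def scalarRep {n : ℕ} (φ : Fin n → FreeHolomorphic n) (z : EuclideanSpace ℂ (Fin n)) :
    EuclideanSpace ℂ (Fin n) :=
  WithLp.toLp 2 (fun i => (φ i).eval (fun j => z j))

/-- The noncommutative Hardy space `H²_ball`: power series `∑ a_α Z_α` with `∑ |a_α|² < ∞`, with
the inner product and norm of the coefficient sequences. -/
abbrev HardySpace (n : ℕ) : Type := lp (fun _ : FreeMonoid (Fin n) => ℂ) 2

theorem word_injective {n k : ℕ} : Function.Injective (word : (Fin k → Fin n) → _) := by
  intro v w h
  exact List.ofFn_injective (FreeMonoid.ofList.injective h)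

theorem radius_of_summable {n : ℕ} (a : FreeMonoid (Fin n) → ℂ)
    (hsum : Summable fun α => ‖a α‖ ^ 2) :
    limsup (fun k : ℕ => ENNReal.ofReal
      ((∑ w : Fin k → Fin n, ‖a (word w)‖ ^ 2) ^ (1 / (2 * (k : ℝ))))) atTop ≤ 1 := by
  set M : ℝ := (∑' α, ‖a α‖ ^ 2) + 1 with hM
  have hM0 : 0 < M := by
    have : 0 ≤ ∑' α, ‖a α‖ ^ 2 := tsum_nonneg fun _ => by positivity
    linarith
  have hle : ∀ k : ℕ, ∑ w : Fin k → Fin n, ‖a (word w)‖ ^ 2 ≤ M := by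
    intro k
    have h1 := hsum.sum_le_tsum (Finset.univ.map ⟨word, word_injective (n := n) (k := k)⟩)
      fun _ _ => by positivity
    rw [Finset.sum_map] at h1
    simp only [Function.Embedding.coeFn_mk] at h1
    linarith
  have hlim : Tendsto (fun k : ℕ => ENNReal.ofReal (M ^ (1 / (2 * (k : ℝ))))) atTop (𝓝 1) := by
    have h0 : Tendsto (fun k : ℕ => 1 / (2 * (k : ℝ))) atTop (𝓝 0) :=
      (tendsto_natCast_atTop_atTop.const_mul_atTop (by norm_num : (0 : ℝ) < 2)).const_div_atTop 1
    have h2 := (Real.continuousAt_const_rpow hM0.ne' (b := 0)).tendsto.comp h0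
    rw [Real.rpow_zero] at h2
    simpa using ENNReal.tendsto_ofReal h2
  rw [← hlim.limsup_eq]
  refine limsup_le_limsup (Eventually.of_forall fun k => ?_)
  exact ENNReal.ofReal_le_ofReal
    (Real.rpow_le_rpow (Finset.sum_nonneg fun _ _ => by positivity) (hle k) (by positivity))

theorem HardySpace.radius {n : ℕ} (f : HardySpace n) :
    limsup (fun k : ℕ => ENNReal.ofReal
      ((∑ w : Fin k → Fin n, ‖f (word w)‖ ^ 2) ^ (1 / (2 * (k : ℝ))))) atTop ≤ 1 :=
  radius_of_summable f (by simpa using (lp.memℓp f).summable (by norm_num))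

/-- An element of `H²_ball` as a free holomorphic function. -/
def HardySpace.toFreeHolomorphic {n : ℕ} (f : HardySpace n) : FreeHolomorphic n where
  coeff := f
  radius := f.radius

/-- `C` is the composition operator `C_φ` on `H²_ball`: for every `f` in `H²_ball`, the function
`C f` is `f ∘ φ` on `[B(H)^n]_1`. -/
def IsCompositionOperator {n : ℕ} (H : Type*) [NormedAddCommGroup H] [InnerProductSpace ℂ H]
    [CompleteSpace H] (φ : Fin n → FreeHolomorphic n) (C : HardySpace n →L[ℂ] HardySpace n) :
    Prop :=
  ∀ f : HardySpace n, ∀ X ∈ ncBall n H,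
    (C f).toFreeHolomorphic.eval X = f.toFreeHolomorphic.eval (fun i => (φ i).eval X)

theorem FreeHolomorphic.summable_of_bound {n : ℕ} {A : Type*} [NormedRing A] [NormedAlgebra ℂ A]
    [CompleteSpace A] (f : FreeHolomorphic n) (X : Fin n → A) (r : ℝ) (hr0 : 0 ≤ r) (hr1 : r < 1)
    (h : ∀ k, ‖f.homogeneousPart k X‖ ≤ √(∑ w : Fin k → Fin n, ‖f.coeff (word w)‖ ^ 2) * r ^ k) :
    Summable fun k => f.homogeneousPart k X := by
  obtain ⟨s, hs1, hsr⟩ : ∃ s : ℝ, 1 < s ∧ s * r < 1 := by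
    rcases hr0.eq_or_lt with rfl | hr0
    · exact ⟨2, by norm_num, by norm_num⟩
    · obtain ⟨s, h1, h2⟩ := exists_between ((one_lt_inv₀ hr0).2 hr1)
      refine ⟨s, h1, ?_⟩
      have := mul_lt_mul_of_pos_right h2 hr0
      rwa [inv_mul_cancel₀ hr0.ne'] at this
  have hs0 : 0 < s := by linarith
  have hev := eventually_lt_of_limsup_lt (lt_of_le_of_lt f.radius
    (show (1 : ℝ≥0∞) < ENNReal.ofReal s by simpa using hs1))
  refine Summable.of_norm_bounded_eventually_nat (g := fun k => (s * r) ^ k)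
    (summable_geometric_of_lt_one (by positivity) hsr) ?_
  filter_upwards [hev, eventually_gt_atTop 0] with k hk hk0
  have hk0' : (0 : ℝ) < k := by exact_mod_cast hk0
  rw [ENNReal.ofReal_lt_ofReal_iff hs0] at hk
  set T := ∑ w : Fin k → Fin n, ‖f.coeff (word w)‖ ^ 2
  have hT : 0 ≤ T := Finset.sum_nonneg fun _ _ => by positivity
  have h3 : √T ≤ s ^ k := by
    have h4 := pow_le_pow_left₀ (by positivity) hk.le k
    rwa [← Real.rpow_natCast, ← Real.rpow_mul hT,
      show 1 / (2 * (k : ℝ)) * k = 1 / 2 by field_simp, ← Real.sqrt_eq_rpow] at h4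
  rw [mul_pow]
  exact (h k).trans (mul_le_mul_of_nonneg_right h3 (by positivity))

theorem ncBall_sum_adjoint_le {n : ℕ} {H : Type*} [NormedAddCommGroup H] [InnerProductSpace ℂ H]
    [CompleteSpace H] (X : Fin n → (H →L[ℂ] H)) (h : H) :
    ∑ i, ‖ContinuousLinearMap.adjoint (X i) h‖ ^ 2 ≤
      ‖∑ i, X i * ContinuousLinearMap.adjoint (X i)‖ * ‖h‖ ^ 2 := by
  have h1 : (((∑ i, ‖ContinuousLinearMap.adjoint (X i) h‖ ^ 2 : ℝ)) : ℂ) =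
      inner ℂ h ((∑ i, X i * ContinuousLinearMap.adjoint (X i)) h) := by
    rw [sum_apply, inner_sum]
    push_cast
    refine Finset.sum_congr rfl fun i _ => ?_
    change _ = inner ℂ h (X i (ContinuousLinearMap.adjoint (X i) h))
    rw [← ContinuousLinearMap.adjoint_inner_left, inner_self_eq_norm_sq_to_K]
    rfl
  have h2 := norm_inner_le_norm (𝕜 := ℂ) h ((∑ i, X i * ContinuousLinearMap.adjoint (X i)) h)
  rw [← h1, Complex.norm_real, Real.norm_of_nonneg (Finset.sum_nonneg fun _ _ => by positivity)]
    at h2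
  have h3 := (∑ i, X i * ContinuousLinearMap.adjoint (X i)).le_opNorm h
  nlinarith [norm_nonneg h]

theorem sum_adjoint_word_le {n : ℕ} {H : Type*} [NormedAddCommGroup H] [InnerProductSpace ℂ H]
    [CompleteSpace H] (X : Fin n → (H →L[ℂ] H)) (k : ℕ) (h : H) :
    ∑ w : Fin k → Fin n, ‖ContinuousLinearMap.adjoint (FreeMonoid.lift X (word w)) h‖ ^ 2 ≤
      ‖∑ i, X i * ContinuousLinearMap.adjoint (X i)‖ ^ k * ‖h‖ ^ 2 := by
  induction k generalizing h with
  | zero =>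
    have h1 : ContinuousLinearMap.adjoint (1 : H →L[ℂ] H) = 1 := ContinuousLinearMap.adjoint_id
    simp [word, h1]
  | succ k ih =>
    rw [← (Fin.consEquiv fun _ => Fin n).sum_comp, Fintype.sum_prod_type]
    have h1 : ∀ (i : Fin n) (w : Fin k → Fin n),
        ContinuousLinearMap.adjoint (FreeMonoid.lift X
          (word ((Fin.consEquiv fun _ => Fin n) (i, w)))) h =
        ContinuousLinearMap.adjoint (FreeMonoid.lift X (word w))
          (ContinuousLinearMap.adjoint (X i) h) := by
      intro i w
      have : word ((Fin.consEquiv fun _ => Fin n) (i, w)) = FreeMonoid.of i * word w := by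
        simp [word, Fin.consEquiv, List.ofFn_succ]
      rw [this, map_mul, FreeMonoid.lift_eval_of]
      change (ContinuousLinearMap.adjoint (X i ∘L _)) h = _
      rw [ContinuousLinearMap.adjoint_comp]
      rfl
    simp only [h1]
    calc _ ≤ ∑ i, ‖∑ i, X i * ContinuousLinearMap.adjoint (X i)‖ ^ k *
          ‖ContinuousLinearMap.adjoint (X i) h‖ ^ 2 := Finset.sum_le_sum fun i _ => ih _
      _ ≤ _ := by
        rw [← Finset.mul_sum, pow_succ, mul_assoc]
        exact mul_le_mul_of_nonneg_left (ncBall_sum_adjoint_le X h) (by positivity)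

/-- On `[B(H)^n]_1` the series defining `f(X)` converges in the operator norm. -/
theorem FreeHolomorphic.summable_of_mem_ncBall {n : ℕ} {H : Type*} [NormedAddCommGroup H]
    [InnerProductSpace ℂ H] [CompleteSpace H] (f : FreeHolomorphic n) (X : Fin n → (H →L[ℂ] H))
    (hX : X ∈ ncBall n H) : Summable fun k => f.homogeneousPart k X := by
  refine f.summable_of_bound X _ (Real.sqrt_nonneg _) hX fun k => ?_
  rw [← LinearIsometryEquiv.norm_map ContinuousLinearMap.adjoint]
  refine ContinuousLinearMap.opNorm_le_bound _ (by positivity) fun h => ?_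
  have h0 : ContinuousLinearMap.adjoint (f.homogeneousPart k X) h =
      ∑ w : Fin k → Fin n, (starRingEnd ℂ) (f.coeff (word w)) •
        ContinuousLinearMap.adjoint (FreeMonoid.lift X (word w)) h := by
    rw [FreeHolomorphic.homogeneousPart, map_sum, sum_apply]
    refine Finset.sum_congr rfl fun w _ => ?_
    rw [LinearIsometryEquiv.map_smulₛₗ]
    rfl
  rw [h0]
  calc _ ≤ ∑ w : Fin k → Fin n, ‖f.coeff (word w)‖ *
        ‖ContinuousLinearMap.adjoint (FreeMonoid.lift X (word w)) h‖ := by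
        refine (norm_sum_le _ _).trans (le_of_eq ?_)
        simp [norm_smul]
    _ ≤ _ := Real.sum_mul_le_sqrt_mul_sqrt _ _ _
    _ ≤ _ := by
        rw [mul_assoc]
        refine mul_le_mul_of_nonneg_left ?_ (by positivity)
        refine Real.sqrt_le_iff.2 ⟨by positivity, (sum_adjoint_word_le X k h).trans (le_of_eq ?_)⟩
        rw [mul_pow, ← pow_mul, mul_comm k 2, pow_mul, Real.sq_sqrt (norm_nonneg _)]

theorem sum_norm_word_sq {n : ℕ} (z : EuclideanSpace ℂ (Fin n)) (k : ℕ) :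
    ∑ w : Fin k → Fin n, ‖FreeMonoid.lift (fun j => z j) (word w)‖ ^ 2 = (‖z‖ ^ k) ^ 2 := by
  induction k with
  | zero => simp [word]
  | succ k ih =>
    rw [← (Fin.consEquiv fun _ => Fin n).sum_comp, Fintype.sum_prod_type]
    have h1 : ∀ (i : Fin n) (w : Fin k → Fin n),
        FreeMonoid.lift (fun j => z j) (word ((Fin.consEquiv fun _ => Fin n) (i, w))) =
          z i * FreeMonoid.lift (fun j => z j) (word w) := by
      intro i w
      simp [word, Fin.consEquiv, List.ofFn_succ]
    simp only [h1, norm_mul, mul_pow, ← Finset.mul_sum, ih]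
    rw [← Finset.sum_mul, ← EuclideanSpace.norm_sq_eq]
    ring

/-- On the open Euclidean unit ball the series defining the scalar value `f(z)` converges. -/
theorem FreeHolomorphic.summable_of_mem_ball {n : ℕ} (f : FreeHolomorphic n)
    (z : EuclideanSpace ℂ (Fin n)) (hz : ‖z‖ < 1) :
    Summable fun k => f.homogeneousPart k (fun j => z j) := by
  refine f.summable_of_bound _ _ (norm_nonneg z) hz fun k => ?_
  calc _ ≤ ∑ w : Fin k → Fin n, ‖f.coeff (word w)‖ *
        ‖FreeMonoid.lift (fun j => z j) (word w)‖ := by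
        refine (norm_sum_le _ _).trans (le_of_eq ?_)
        simp
    _ ≤ _ := Real.sum_mul_le_sqrt_mul_sqrt _ _ _
    _ = _ := by rw [sum_norm_word_sq, Real.sqrt_sq (by positivity)]

end

/-!
The composition operator is built from left multiplication by the components of `φ`, and its norm
is estimated by one inequality for row contractions.

*Multiplication operators.* An infinite-dimensional `H` contains an isometric copy of the Hardy
space, on which the tuple `r L = (r L₁, …, r Lₙ)` of scaled left creation operators, extended by
zero, lies in the open ball for `0 ≤ r < 1`. There `f(r L)` acts on coefficients as the Cauchy
product by `f(r Z)` (`inner_eval_shiftModel`). Applying the self-map property at `r L` and letting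
`r → 1` coefficientwise shows that left multiplication by `φ₁, …, φₙ` is a row contraction `T` on
the Hardy space (`sum_norm_sq_sum_cauchyProduct_le`). The unit vector `Ω = 1` satisfies
`Tᵢ* Ω = conj φᵢ(0) Ω`. The same evaluation at `r L` recovers the coefficients of a power series,
which gives the uniqueness of the composition operator (`HardySpace.eq_of_eval_eq`).

*Upper bound.* Let `T` be any row contraction with `Tᵢ* Ω = cᵢ Ω` and `c = ‖(cᵢ)‖ < 1`.
Cauchy–Schwarz for the positive form `⟪(1 - ∑ Tᵢ Tᵢ*) x, y⟫` gives
`|⟪Ω, y⟫|² ≤ (1 + c) (‖y‖² - ∑ ‖Tᵢ* y‖²) + c ∑ |⟪Ω, Tᵢ* y⟫|²`. With `y = T_α* x`, the sum over all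
words `α` telescopes to `∑ |⟪T_α Ω, x⟫|² ≤ (1 + c) / (1 - c) ‖x‖²`
(`summable_and_tsum_norm_sq_inner_le`). By duality `f ↦ f(T) Ω` is a bounded operator with the
required norm bound. For the multiplication operators, `T_α Ω` is the power series `φ_α`, so this
operator is composition with `φ` on monomials, and on all of the Hardy space since point
evaluations are continuous (`isCompositionOperator_of_apply_single`).

*Lower bound.* The scalar points `z` of the Euclidean ball correspond to the tuples
`(z₁ I, …, zₙ I)` of the operator ball. The adjoint of the composition operator maps the kernel
vector at `z`, whose squared norm is `1 / (1 - ‖z‖²)`, to the kernel vector at `φ(z)`. The point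
`z = 0` gives the first inequality.
-/

noncomputable section

/-! ### Formal power series in noncommuting variables -/

/-- The Cauchy product of two formal power series: the coefficient at `γ` sums `a β * b δ` over the
factorizations `γ = β δ`, each of which is determined by the length of `β`. -/
def cauchyProduct {n : ℕ} (a b : FreeMonoid (Fin n) → ℂ) (γ : FreeMonoid (Fin n)) : ℂ :=
  ∑ p ∈ Finset.HasAntidiagonal.antidiagonal γ.toList.length,
    a (FreeMonoid.ofList (γ.toList.take p.1)) * b (FreeMonoid.ofList (γ.toList.drop p.1))

theorem toList_word {n k : ℕ} (w : Fin k → Fin n) : (word w).toList = List.ofFn w := rfl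

theorem length_word {n k : ℕ} (w : Fin k → Fin n) : (word w).toList.length = k := by
  simp [toList_word]

theorem word_append {n j k : ℕ} (u : Fin j → Fin n) (v : Fin k → Fin n) :
    word (Fin.append u v) = word u * word v := by
  simp [word]

theorem word_snoc {n k : ℕ} (w : Fin k → Fin n) (i : Fin n) :
    word (Fin.snoc w i : Fin (k + 1) → Fin n) = word w * FreeMonoid.of i := by
  apply FreeMonoid.toList.injective
  simp [toList_word, List.ofFn_succ_last, -List.ofFn_succ]

theorem word_cons {n k : ℕ} (w : Fin k → Fin n) (i : Fin n) :
    word (Fin.cons i w : Fin (k + 1) → Fin n) = FreeMonoid.of i * word w := by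
  simp [word]

theorem word_elim0 {n : ℕ} (w : Fin 0 → Fin n) : word w = 1 := by
  simp [word]

theorem exists_word_eq {n k : ℕ} (γ : FreeMonoid (Fin n)) (h : γ.toList.length = k) :
    ∃ w : Fin k → Fin n, word w = γ := by
  subst h
  exact ⟨γ.toList.get, by simp [word]⟩

/-- Every word has a unique length and a unique tuple of letters. -/
def wordEquiv (n : ℕ) : (Σ k, Fin k → Fin n) ≃ FreeMonoid (Fin n) :=
  List.equivSigmaTuple.symm.trans FreeMonoid.ofList

theorem wordEquiv_apply {n : ℕ} (p : Σ k, Fin k → Fin n) : wordEquiv n p = word p.2 := rfl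

/-- A family of nonnegative numbers indexed by words is summable, with the expected bound, once the
sums over the words of length less than `N` are bounded. -/
theorem summable_and_tsum_le_of_levels {n : ℕ} {g : FreeMonoid (Fin n) → ℝ} (hg : ∀ α, 0 ≤ g α)
    {B : ℝ} (h : ∀ N, ∑ k ∈ Finset.range N, ∑ w : Fin k → Fin n, g (word w) ≤ B) :
    Summable g ∧ ∑' α, g α ≤ B := by
  have hs : Summable fun k => ∑ w : Fin k → Fin n, g (word w) :=
    summable_of_sum_range_le (fun k => Finset.sum_nonneg fun w _ => hg _) h
  have h1 : Summable fun p : Σ k, Fin k → Fin n => g (wordEquiv n p) := by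
    rw [summable_sigma_of_nonneg fun p => hg _]
    refine ⟨fun k => Summable.of_finite, ?_⟩
    simpa only [tsum_fintype, wordEquiv_apply] using hs
  refine ⟨(wordEquiv n).summable_iff.1 h1, ?_⟩
  rw [← (wordEquiv n).tsum_eq, h1.tsum_sigma]
  simp only [tsum_fintype]
  exact hs.tsum_le_of_sum_range_le h

theorem cauchyProduct_word_append {n : ℕ} (a b : FreeMonoid (Fin n) → ℂ) {j k : ℕ}
    (u : Fin j → Fin n) (v : Fin k → Fin n) :
    a (FreeMonoid.ofList ((word (Fin.append u v)).toList.take j)) *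
      b (FreeMonoid.ofList ((word (Fin.append u v)).toList.drop j)) = a (word u) * b (word v) := by
  have h : (List.ofFn u).length = j := by simp
  rw [toList_word, List.ofFn_fin_append, List.take_left' h, List.drop_left' h]
  rfl

/-- The homogeneous part of degree `k` of a Cauchy product. -/
theorem sum_cauchyProduct_smul_lift {n : ℕ} {A : Type*} [NormedRing A] [NormedAlgebra ℂ A]
    (a b : FreeMonoid (Fin n) → ℂ) (X : Fin n → A) (k : ℕ) :
    ∑ w : Fin k → Fin n, cauchyProduct a b (word w) • FreeMonoid.lift X (word w) =
      ∑ p ∈ Finset.HasAntidiagonal.antidiagonal k,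
        (∑ u : Fin p.1 → Fin n, a (word u) • FreeMonoid.lift X (word u)) *
          ∑ v : Fin p.2 → Fin n, b (word v) • FreeMonoid.lift X (word v) := by
  simp only [cauchyProduct, length_word, Finset.sum_smul]
  rw [Finset.sum_comm]
  refine Finset.sum_congr rfl fun p hp => ?_
  obtain ⟨j, l⟩ := p
  rw [Finset.HasAntidiagonal.mem_antidiagonal] at hp
  subst hp
  rw [Finset.sum_mul_sum, ← (Fin.appendEquiv j l).sum_comp, Fintype.sum_prod_type]
  refine Finset.sum_congr rfl fun u _ => Finset.sum_congr rfl fun v _ => ?_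
  rw [show Fin.appendEquiv j l (u, v) = Fin.append u v from rfl, cauchyProduct_word_append,
    word_append, map_mul, smul_mul_smul_comm]

theorem cauchyProduct_add_right {n : ℕ} (a b c : FreeMonoid (Fin n) → ℂ) :
    cauchyProduct a (b + c) = cauchyProduct a b + cauchyProduct a c := by
  ext γ
  simp [cauchyProduct, mul_add, Finset.sum_add_distrib]

theorem cauchyProduct_smul_right {n : ℕ} (a b : FreeMonoid (Fin n) → ℂ) (c : ℂ) :
    cauchyProduct a (c • b) = c • cauchyProduct a b := by
  ext γ
  simp [cauchyProduct, Finset.mul_sum, mul_left_comm]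

theorem cauchyProduct_one {n : ℕ} (a b : FreeMonoid (Fin n) → ℂ) :
    cauchyProduct a b 1 = a 1 * b 1 := by
  simp [cauchyProduct]

/-! ### Evaluation of power series -/

variable {n : ℕ} {H : Type*} [NormedAddCommGroup H] [InnerProductSpace ℂ H] [CompleteSpace H]

theorem ncBall_smul_mem_of_one_lt {X : Fin n → (H →L[ℂ] H)} (hX : X ∈ ncBall n H) :
    ∃ s : ℝ, 1 < s ∧ (fun i => (s : ℂ) • X i) ∈ ncBall n H := by
  set M := √‖∑ i, X i * ContinuousLinearMap.adjoint (X i)‖ with hM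
  have hX' : M < 1 := hX
  have hM0 : 0 ≤ M := Real.sqrt_nonneg _
  obtain ⟨s, hs1, hs⟩ : ∃ s : ℝ, 1 < s ∧ s * M < 1 := by
    have hlim : Tendsto (fun s : ℝ => s * M) (𝓝[>] 1) (𝓝 (1 * M)) :=
      (continuous_id.mul continuous_const).continuousAt.tendsto.mono_left nhdsWithin_le_nhds
    rw [one_mul] at hlim
    obtain ⟨s, h1, h2⟩ := ((hlim.eventually_lt_const hX').and self_mem_nhdsWithin).exists
    exact ⟨s, h2, h1⟩
  refine ⟨s, hs1, ?_⟩
  have h1 : ∑ i, ((s : ℂ) • X i) * ContinuousLinearMap.adjoint ((s : ℂ) • X i) =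
      ((s : ℂ) ^ 2) • ∑ i, X i * ContinuousLinearMap.adjoint (X i) := by
    rw [Finset.smul_sum]
    refine Finset.sum_congr rfl fun i _ => ?_
    rw [LinearIsometryEquiv.map_smulₛₗ, smul_mul_smul_comm, Complex.conj_ofReal, sq]
  change √‖_‖ < 1
  rw [h1, norm_smul, Real.sqrt_mul (norm_nonneg _), ← hM]
  simpa [Real.sqrt_sq (by positivity : 0 ≤ s), abs_of_pos (by linarith : 0 < s)] using hs

theorem lift_smul_word {A : Type*} [NormedRing A] [NormedAlgebra ℂ A] (c : ℂ) (X : Fin n → A)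
    {k : ℕ} (w : Fin k → Fin n) :
    FreeMonoid.lift (fun i => c • X i) (word w) = c ^ k • FreeMonoid.lift X (word w) := by
  induction k with
  | zero => simp [word_elim0]
  | succ k ih =>
    rw [← Fin.cons_self_tail w, word_cons, map_mul, map_mul, ih, FreeMonoid.lift_eval_of,
      FreeMonoid.lift_eval_of, smul_mul_smul_comm, pow_succ']

/-- On the open ball the series of homogeneous parts converges absolutely: a dilation of the point
by some `s > 1` still lies in the ball, so that the parts of degree `k` are `O(s⁻ᵏ)`. -/
theorem FreeHolomorphic.summable_norm_of_mem_ncBall (f : FreeHolomorphic n)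
    {X : Fin n → (H →L[ℂ] H)} (hX : X ∈ ncBall n H) :
    Summable fun k => ‖f.homogeneousPart k X‖ := by
  obtain ⟨s, hs1, hs⟩ := ncBall_smul_mem_of_one_lt hX
  have h0 := (f.summable_of_mem_ncBall _ hs).tendsto_atTop_zero.norm
  rw [norm_zero] at h0
  refine Summable.of_norm_bounded_eventually_nat (g := fun k => (s⁻¹) ^ k)
    (summable_geometric_of_lt_one (by positivity) (inv_lt_one_of_one_lt₀ hs1)) ?_
  filter_upwards [h0.eventually_le_const zero_lt_one] with k hk
  have h1 : f.homogeneousPart k (fun i => (s : ℂ) • X i) =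
      (s : ℂ) ^ k • f.homogeneousPart k X := by
    simp only [FreeHolomorphic.homogeneousPart, lift_smul_word, Finset.smul_sum]
    exact Finset.sum_congr rfl fun w _ => smul_comm _ _ _
  rw [h1, norm_smul, norm_pow, Complex.norm_real, Real.norm_of_nonneg (by linarith)] at hk
  rw [norm_norm, inv_pow, ← one_div, le_div_iff₀' (by positivity)]
  exact hk

theorem HardySpace.norm_sq_eq (f : HardySpace n) : ‖f‖ ^ 2 = ∑' α, ‖f α‖ ^ 2 := by
  simpa using lp.norm_rpow_eq_tsum (p := 2) (by norm_num) f

theorem HardySpace.summable_norm_sq (f : HardySpace n) : Summable fun α => ‖f α‖ ^ 2 := by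
  simpa using (lp.memℓp f).summable (by norm_num)

theorem HardySpace.sum_level_le (f : HardySpace n) (k : ℕ) :
    ∑ w : Fin k → Fin n, ‖f (word w)‖ ^ 2 ≤ ‖f‖ ^ 2 := by
  rw [f.norm_sq_eq]
  have h1 := f.summable_norm_sq.sum_le_tsum
    (Finset.univ.map ⟨word, word_injective (n := n) (k := k)⟩) fun _ _ => by positivity
  rwa [Finset.sum_map] at h1

theorem norm_sum_smul_lift_le (a : FreeMonoid (Fin n) → ℂ) (X : Fin n → (H →L[ℂ] H)) (k : ℕ) :
    ‖∑ w : Fin k → Fin n, a (word w) • FreeMonoid.lift X (word w)‖ ≤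
      √(∑ w : Fin k → Fin n, ‖a (word w)‖ ^ 2) *
        √‖∑ i, X i * ContinuousLinearMap.adjoint (X i)‖ ^ k := by
  rw [← LinearIsometryEquiv.norm_map ContinuousLinearMap.adjoint]
  refine ContinuousLinearMap.opNorm_le_bound _ (by positivity) fun h => ?_
  have h0 : ContinuousLinearMap.adjoint
        (∑ w : Fin k → Fin n, a (word w) • FreeMonoid.lift X (word w)) h =
      ∑ w : Fin k → Fin n, (starRingEnd ℂ) (a (word w)) •
        ContinuousLinearMap.adjoint (FreeMonoid.lift X (word w)) h := by
    rw [map_sum, sum_apply]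
    refine Finset.sum_congr rfl fun w _ => ?_
    rw [LinearIsometryEquiv.map_smulₛₗ]
    rfl
  rw [h0]
  calc _ ≤ ∑ w : Fin k → Fin n, ‖a (word w)‖ *
        ‖ContinuousLinearMap.adjoint (FreeMonoid.lift X (word w)) h‖ := by
        refine (norm_sum_le _ _).trans (le_of_eq ?_)
        simp [norm_smul]
    _ ≤ _ := Real.sum_mul_le_sqrt_mul_sqrt _ _ _
    _ ≤ _ := by
        rw [mul_assoc]
        refine mul_le_mul_of_nonneg_left ?_ (by positivity)
        refine Real.sqrt_le_iff.2 ⟨by positivity, (sum_adjoint_word_le X k h).trans (le_of_eq ?_)⟩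
        rw [mul_pow, ← pow_mul, mul_comm k 2, pow_mul, Real.sq_sqrt (norm_nonneg _)]

/-- Evaluation at a point of the open ball, as a bounded linear map on the Hardy space. -/
def HardySpace.evalCLM (X : Fin n → (H →L[ℂ] H)) (hX : X ∈ ncBall n H) :
    HardySpace n →L[ℂ] (H →L[ℂ] H) :=
  LinearMap.mkContinuous
    { toFun := fun f => f.toFreeHolomorphic.eval X
      map_add' := fun f g => by
        simp only [FreeHolomorphic.eval]
        rw [← (f.toFreeHolomorphic.summable_of_mem_ncBall X hX).tsum_add
          (g.toFreeHolomorphic.summable_of_mem_ncBall X hX)]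
        refine tsum_congr fun k => ?_
        simp [FreeHolomorphic.homogeneousPart, HardySpace.toFreeHolomorphic, add_smul,
          Finset.sum_add_distrib]
      map_smul' := fun c f => by
        simp only [FreeHolomorphic.eval, RingHom.id_apply]
        rw [← (f.toFreeHolomorphic.summable_of_mem_ncBall X hX).tsum_const_smul c]
        refine tsum_congr fun k => ?_
        simp [FreeHolomorphic.homogeneousPart, HardySpace.toFreeHolomorphic, mul_smul,
          Finset.smul_sum] }
    (1 - √‖∑ i, X i * ContinuousLinearMap.adjoint (X i)‖)⁻¹ fun f => by
      have hr : √‖∑ i, X i * ContinuousLinearMap.adjoint (X i)‖ < 1 := hX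
      have h1 := (hasSum_geometric_of_lt_one (Real.sqrt_nonneg _) hr).mul_right ‖f‖
      refine tsum_of_norm_bounded h1 fun k => ?_
      refine (norm_sum_smul_lift_le f X k).trans ?_
      rw [mul_comm]
      refine mul_le_mul_of_nonneg_left ?_ (by positivity)
      exact Real.sqrt_le_iff.2 ⟨norm_nonneg _, f.sum_level_le k⟩

theorem HardySpace.evalCLM_apply (X : Fin n → (H →L[ℂ] H)) (hX : X ∈ ncBall n H)
    (f : HardySpace n) : HardySpace.evalCLM X hX f = f.toFreeHolomorphic.eval X := rfl

/-- Evaluation turns the Cauchy product of coefficient families into the product of operators. -/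
theorem FreeHolomorphic.eval_mul_of_coeff_eq {f g h : FreeHolomorphic n}
    (hfg : h.coeff = cauchyProduct f.coeff g.coeff) {X : Fin n → (H →L[ℂ] H)}
    (hX : X ∈ ncBall n H) : h.eval X = f.eval X * g.eval X := by
  rw [FreeHolomorphic.eval, FreeHolomorphic.eval, FreeHolomorphic.eval,
    tsum_mul_tsum_eq_tsum_sum_antidiagonal_of_summable_norm (f.summable_norm_of_mem_ncBall hX)
      (g.summable_norm_of_mem_ncBall hX)]
  refine tsum_congr fun k => ?_
  simp only [FreeHolomorphic.homogeneousPart, hfg]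
  exact sum_cauchyProduct_smul_lift _ _ _ _

open Classical in
theorem HardySpace.eval_single (α : FreeMonoid (Fin n)) {A : Type*} [NormedRing A]
    [NormedAlgebra ℂ A] (X : Fin n → A) :
    (HardySpace.toFreeHolomorphic (lp.single 2 α (1 : ℂ) : HardySpace n)).eval X =
      FreeMonoid.lift X α := by
  obtain ⟨m, hm⟩ : ∃ m, α.toList.length = m := ⟨_, rfl⟩
  obtain ⟨w, rfl⟩ := exists_word_eq α hm
  rw [FreeHolomorphic.eval, tsum_eq_single m]
  · rw [FreeHolomorphic.homogeneousPart, Finset.sum_eq_single w]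
    · simp [HardySpace.toFreeHolomorphic]
    · intro v _ hv
      simp [HardySpace.toFreeHolomorphic, lp.single_apply, word_injective.eq_iff, hv]
    · simp
  · intro k hk
    refine Finset.sum_eq_zero fun v _ => ?_
    have : word v ≠ word w := fun h => hk (by
      rw [← length_word v, ← length_word w, h])
    simp [HardySpace.toFreeHolomorphic, lp.single_apply, this]

/-! ### Row contractions with a joint eigenvector of the adjoints -/

variable {K : Type*} [NormedAddCommGroup K] [InnerProductSpace ℂ K] [CompleteSpace K]

/-- The Cauchy–Schwarz inequality for the positive semidefinite form `⟪(1 - ∑ Tᵢ Tᵢ*) x, y⟫`. -/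
theorem norm_sq_defect_form_le {T : Fin n → (K →L[ℂ] K)}
    (hT : ∀ x, ∑ i, ‖ContinuousLinearMap.adjoint (T i) x‖ ^ 2 ≤ ‖x‖ ^ 2) (x y : K) :
    ‖inner ℂ x y - ∑ i, inner ℂ (ContinuousLinearMap.adjoint (T i) x)
        (ContinuousLinearMap.adjoint (T i) y)‖ ^ 2 ≤
      (‖x‖ ^ 2 - ∑ i, ‖ContinuousLinearMap.adjoint (T i) x‖ ^ 2) *
        (‖y‖ ^ 2 - ∑ i, ‖ContinuousLinearMap.adjoint (T i) y‖ ^ 2) := by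
  let B : K → K → ℂ := fun x y => inner ℂ x y -
    ∑ i, inner ℂ (ContinuousLinearMap.adjoint (T i) x) (ContinuousLinearMap.adjoint (T i) y)
  have hself : ∀ x, RCLike.re (B x x) =
      ‖x‖ ^ 2 - ∑ i, ‖ContinuousLinearMap.adjoint (T i) x‖ ^ 2 := fun x => by
    simp only [B, map_sub, map_sum, inner_self_eq_norm_sq]
  have hsymm : ∀ x y, (starRingEnd ℂ) (B y x) = B x y := fun x y => by
    simp only [B, map_sub, map_sum, inner_conj_symm]
  let c : PreInnerProductSpace.Core ℂ K :=
    { inner := B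
      conj_inner_symm := hsymm
      re_inner_nonneg := fun x => by
        rw [hself]
        linarith [hT x]
      add_left := fun x y z => by
        simp only [B, map_add, inner_add_left, Finset.sum_add_distrib]
        ring
      smul_left := fun x y r => by
        simp only [B, map_smul, inner_smul_left, ← Finset.mul_sum]
        ring }
  have h := @InnerProductSpace.Core.inner_mul_inner_self_le ℂ K _ _ _ c x y
  change ‖B x y‖ * ‖B y x‖ ≤ RCLike.re (B x x) * RCLike.re (B y y) at h
  rw [hself, hself, ← hsymm y x, RCLike.norm_conj, ← sq] at h
  exact h

/-- The one-step estimate behind the norm bound. With `c = ‖(cᵢ)‖`, Cauchy–Schwarz for the defect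
form bounds `v = ⟪Ω, y⟫ - ∑ conj cᵢ ⟪Ω, Tᵢ* y⟫`, and convexity of the square gives
`(|v| + c q)² ≤ |v|² / (1 - c) + c q²`. -/
theorem norm_sq_inner_le_of_adjoint_apply_eq_smul {T : Fin n → (K →L[ℂ] K)}
    (hT : ∀ x, ∑ i, ‖ContinuousLinearMap.adjoint (T i) x‖ ^ 2 ≤ ‖x‖ ^ 2) {Ω : K} (hΩ : ‖Ω‖ = 1)
    {c : EuclideanSpace ℂ (Fin n)} (hc : ‖c‖ < 1)
    (hTΩ : ∀ i, ContinuousLinearMap.adjoint (T i) Ω = c i • Ω) (y : K) :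
    ‖(inner ℂ Ω y : ℂ)‖ ^ 2 ≤
      (1 + ‖c‖) * (‖y‖ ^ 2 - ∑ i, ‖ContinuousLinearMap.adjoint (T i) y‖ ^ 2) +
        ‖c‖ * ∑ i, ‖(inner ℂ Ω (ContinuousLinearMap.adjoint (T i) y) : ℂ)‖ ^ 2 := by
  have h1 := norm_sq_defect_form_le hT Ω y
  set Q := ∑ i, ‖(inner ℂ Ω (ContinuousLinearMap.adjoint (T i) y) : ℂ)‖ ^ 2 with hQ
  set D := ‖y‖ ^ 2 - ∑ i, ‖ContinuousLinearMap.adjoint (T i) y‖ ^ 2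
  set w := ∑ i, (inner ℂ (ContinuousLinearMap.adjoint (T i) Ω)
        (ContinuousLinearMap.adjoint (T i) y) : ℂ) with hw
  have hQ0 : 0 ≤ Q := Finset.sum_nonneg fun _ _ => by positivity
  have h2 : ‖Ω‖ ^ 2 - ∑ i, ‖ContinuousLinearMap.adjoint (T i) Ω‖ ^ 2 = 1 - ‖c‖ ^ 2 := by
    simp only [hTΩ, norm_smul, hΩ, mul_one, one_pow, EuclideanSpace.norm_sq_eq]
  rw [h2] at h1
  have h3 : ‖w‖ ≤ ‖c‖ * √Q := by
    rw [EuclideanSpace.norm_eq]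
    calc ‖w‖ ≤ ∑ i, ‖c i‖ * ‖(inner ℂ Ω (ContinuousLinearMap.adjoint (T i) y) : ℂ)‖ := by
          refine (norm_sum_le _ _).trans (le_of_eq ?_)
          simp [hTΩ, mul_comm]
      _ ≤ _ := Real.sum_mul_le_sqrt_mul_sqrt _ _ _
  set v := (inner ℂ Ω y : ℂ) - w with hv
  have h4 : ‖(inner ℂ Ω y : ℂ)‖ ≤ ‖v‖ + ‖c‖ * √Q := by
    have : (inner ℂ Ω y : ℂ) = v + w := by rw [hv]; ring
    rw [this]
    exact (norm_add_le _ _).trans (by linarith)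
  have hc0 := norm_nonneg c
  have hc1 : 0 < 1 - ‖c‖ := by linarith
  have hsq : √Q ^ 2 = Q := Real.sq_sqrt hQ0
  have h5 : ‖(inner ℂ Ω y : ℂ)‖ ^ 2 ≤ (‖v‖ + ‖c‖ * √Q) ^ 2 :=
    pow_le_pow_left₀ (norm_nonneg _) h4 2
  have h6 : (1 - ‖c‖) * (‖v‖ + ‖c‖ * √Q) ^ 2 ≤ ‖v‖ ^ 2 + (1 - ‖c‖) * (‖c‖ * Q) := by
    -- The difference of the two sides is `‖c‖ (‖v‖ - (1 - ‖c‖) √Q)²`.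
    have h : (1 - ‖c‖) * (‖c‖ * Q) = (1 - ‖c‖) * (‖c‖ * √Q ^ 2) := by rw [hsq]
    rw [h]
    nlinarith [mul_nonneg hc0 (sq_nonneg (‖v‖ - (1 - ‖c‖) * √Q))]
  have h7 : (1 - ‖c‖) * ‖(inner ℂ Ω y : ℂ)‖ ^ 2 ≤ (1 - ‖c‖) * ((1 + ‖c‖) * D + ‖c‖ * Q) := by
    nlinarith [mul_le_mul_of_nonneg_left h5 hc1.le]
  exact le_of_mul_le_mul_left h7 hc1

theorem sum_word_succ (g : FreeMonoid (Fin n) → ℝ) (k : ℕ) :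
    ∑ w : Fin (k + 1) → Fin n, g (word w) =
      ∑ w : Fin k → Fin n, ∑ i, g (word w * FreeMonoid.of i) := by
  rw [← (Fin.snocEquiv fun _ => Fin n).sum_comp, Fintype.sum_prod_type_right]
  refine Finset.sum_congr rfl fun w _ => Finset.sum_congr rfl fun i _ => ?_
  rw [← word_snoc]
  rfl

/-- A row contraction `T` with `Tᵢ* Ω = cᵢ Ω` for a unit vector `Ω` and `‖c‖ < 1`: the family
`(T_α Ω)_α` is the image of the standard basis of `ℓ²` under an operator of norm at most
`√((1 + ‖c‖) / (1 - ‖c‖))`. The estimate is stated for the adjoint of that operator. The one-step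
estimate is summed over the words of length less than `N`: the defect terms telescope, and the
boundary term at level `N` tends to zero since the level sums, being bounded in total, are
summable. -/
theorem summable_and_tsum_norm_sq_inner_le {T : Fin n → (K →L[ℂ] K)}
    (hT : ∀ x, ∑ i, ‖ContinuousLinearMap.adjoint (T i) x‖ ^ 2 ≤ ‖x‖ ^ 2) {Ω : K} (hΩ : ‖Ω‖ = 1)
    {c : EuclideanSpace ℂ (Fin n)} (hc : ‖c‖ < 1)
    (hTΩ : ∀ i, ContinuousLinearMap.adjoint (T i) Ω = c i • Ω) (x : K) :
    (Summable fun α => ‖(inner ℂ (FreeMonoid.lift T α Ω) x : ℂ)‖ ^ 2) ∧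
      ∑' α, ‖(inner ℂ (FreeMonoid.lift T α Ω) x : ℂ)‖ ^ 2 ≤
        (1 + ‖c‖) / (1 - ‖c‖) * ‖x‖ ^ 2 := by
  have hc0 := norm_nonneg c
  have hc1 : 0 < 1 - ‖c‖ := by linarith
  set u : FreeMonoid (Fin n) → ℝ := fun α => ‖(inner ℂ (FreeMonoid.lift T α Ω) x : ℂ)‖ ^ 2 with hu
  set d : FreeMonoid (Fin n) → ℝ :=
    fun α => ‖ContinuousLinearMap.adjoint (FreeMonoid.lift T α) x‖ ^ 2 with hd
  set U : ℕ → ℝ := fun k => ∑ w : Fin k → Fin n, u (word w) with hU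
  set D : ℕ → ℝ := fun k => ∑ w : Fin k → Fin n, d (word w) with hD
  have hU0 : ∀ k, 0 ≤ U k := fun k => Finset.sum_nonneg fun _ _ => by positivity
  have hD0 : ∀ k, 0 ≤ D k := fun k => Finset.sum_nonneg fun _ _ => by positivity
  have hadj : ∀ α i, ContinuousLinearMap.adjoint (FreeMonoid.lift T (α * FreeMonoid.of i)) x =
      ContinuousLinearMap.adjoint (T i) (ContinuousLinearMap.adjoint (FreeMonoid.lift T α) x) := by
    intro α i
    rw [map_mul, FreeMonoid.lift_eval_of]
    change (ContinuousLinearMap.adjoint (_ ∘L T i)) x = _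
    rw [ContinuousLinearMap.adjoint_comp]
    rfl
  have hu' : ∀ α, u α =
      ‖(inner ℂ Ω (ContinuousLinearMap.adjoint (FreeMonoid.lift T α) x) : ℂ)‖ ^ 2 := fun α => by
    simp only [hu, ContinuousLinearMap.adjoint_inner_right]
  have hpt : ∀ α, u α ≤ (1 + ‖c‖) * (d α - ∑ i, d (α * FreeMonoid.of i)) +
      ‖c‖ * ∑ i, u (α * FreeMonoid.of i) := fun α => by
    simp only [hu', hd, hadj]
    exact norm_sq_inner_le_of_adjoint_apply_eq_smul hT hΩ hc hTΩ _
  have hstep : ∀ k, U k ≤ (1 + ‖c‖) * (D k - D (k + 1)) + ‖c‖ * U (k + 1) := fun k => by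
    simp only [hU, hD, sum_word_succ]
    rw [← Finset.sum_sub_distrib, Finset.mul_sum, Finset.mul_sum, ← Finset.sum_add_distrib]
    exact Finset.sum_le_sum fun w _ => hpt _
  have hDzero : D 0 = ‖x‖ ^ 2 := by
    have h1 : ContinuousLinearMap.adjoint (1 : K →L[ℂ] K) = 1 := ContinuousLinearMap.adjoint_id
    simp [hD, hd, word_elim0, h1]
  have hDle : ∀ k, D k ≤ ‖x‖ ^ 2 := fun k => by
    induction k with
    | zero => exact hDzero.le
    | succ k ih =>
      refine le_trans ?_ ih
      rw [show D (k + 1) = _ from sum_word_succ d k]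
      simp only [hD, hd, hadj]
      exact Finset.sum_le_sum fun w _ => hT _
  have hUD : ∀ k, U k ≤ D k := fun k => Finset.sum_le_sum fun w _ => by
    rw [hu', hd]
    refine pow_le_pow_left₀ (norm_nonneg _) ((norm_inner_le_norm _ _).trans ?_) 2
    rw [hΩ, one_mul]
  have hsum : ∀ N, (1 - ‖c‖) * ∑ k ∈ Finset.range N, U k ≤ (1 + ‖c‖) * ‖x‖ ^ 2 + ‖c‖ * U N := by
    intro N
    have h1 : ∑ k ∈ Finset.range N, U k ≤
        (1 + ‖c‖) * (D 0 - D N) + ‖c‖ * ∑ k ∈ Finset.range N, U (k + 1) := by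
      rw [← Finset.sum_range_sub', Finset.mul_sum, Finset.mul_sum, ← Finset.sum_add_distrib]
      exact Finset.sum_le_sum fun k _ => hstep k
    have h2 : ∑ k ∈ Finset.range N, U (k + 1) = ∑ k ∈ Finset.range N, U k + U N - U 0 := by
      rw [← Finset.sum_range_succ, Finset.sum_range_succ']
      ring
    rw [h2, hDzero] at h1
    nlinarith [mul_nonneg hc0 (hU0 0), mul_nonneg hc0 (hD0 N), hD0 N]
  have hUs : Summable U := by
    refine summable_of_sum_range_le (c := ((1 + ‖c‖) * ‖x‖ ^ 2 + ‖c‖ * ‖x‖ ^ 2) / (1 - ‖c‖)) hU0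
      fun N => ?_
    rw [le_div_iff₀' hc1]
    have := mul_le_mul_of_nonneg_left ((hUD N).trans (hDle N)) hc0
    linarith [hsum N]
  have htot : (1 - ‖c‖) * ∑' k, U k ≤ (1 + ‖c‖) * ‖x‖ ^ 2 := by
    have h1 := hUs.hasSum.tendsto_sum_nat.const_mul (1 - ‖c‖)
    have h2 := (hUs.tendsto_atTop_zero.const_mul ‖c‖).const_add ((1 + ‖c‖) * ‖x‖ ^ 2)
    rw [mul_zero, add_zero] at h2
    exact le_of_tendsto_of_tendsto' h1 h2 hsum
  refine summable_and_tsum_le_of_levels (fun α => by positivity) fun N => ?_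
  rw [div_mul_eq_mul_div, le_div_iff₀' hc1]
  exact (mul_le_mul_of_nonneg_left (hUs.sum_le_tsum _ fun k _ => hU0 k) hc1.le).trans htot

/-! ### Isometries of `ℓ²` given by orthonormal families -/

section Isometry

variable {ι E : Type*} [NormedAddCommGroup E] [InnerProductSpace ℂ E] [CompleteSpace E]

/-- The isometry of `ℓ²(ι)` that sends the standard basis to a given orthonormal family. -/
def Orthonormal.l2Isometry {v : ι → E} (hv : Orthonormal ℂ v) :
    lp (fun _ : ι => ℂ) 2 →ₗᵢ[ℂ] E :=
  hv.orthogonalFamily.linearIsometry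

theorem Orthonormal.hasSum_inner_l2Isometry {v : ι → E} (hv : Orthonormal ℂ v)
    (f : lp (fun _ : ι => ℂ) 2) (u : E) :
    HasSum (fun i => f i * (inner ℂ u (v i) : ℂ)) (inner ℂ u (hv.l2Isometry f)) := by
  have h := (hv.orthogonalFamily.hasSum_linearIsometry f).mapL (innerSL ℂ u)
  simp only [LinearIsometry.toSpanSingleton_apply, innerSL_apply_apply, inner_smul_right] at h
  exact h

theorem Orthonormal.inner_l2Isometry_self {v : ι → E} (hv : Orthonormal ℂ v)
    (f : lp (fun _ : ι => ℂ) 2) (i : ι) : (inner ℂ (v i) (hv.l2Isometry f) : ℂ) = f i := by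
  classical
  refine (hv.hasSum_inner_l2Isometry f (v i)).unique ?_
  convert hasSum_ite_eq i (f i) using 2 with j
  rw [orthonormal_iff_ite.1 hv]
  split_ifs <;> simp_all

theorem Orthonormal.inner_l2Isometry_of_forall_eq_zero {v : ι → E} (hv : Orthonormal ℂ v)
    (f : lp (fun _ : ι => ℂ) 2) {u : E} (hu : ∀ i, (inner ℂ u (v i) : ℂ) = 0) :
    (inner ℂ u (hv.l2Isometry f) : ℂ) = 0 := by
  refine (hv.hasSum_inner_l2Isometry f u).unique ?_
  simp [hu, hasSum_zero]

end Isometry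

/-! ### The open ball and row contractions -/

theorem le_of_mul_self_le_mul {x c : ℝ} (hx : 0 ≤ x) (hc : 0 ≤ c) (h : x * x ≤ c * x) : x ≤ c := by
  rcases hx.eq_or_lt with rfl | hx
  · exact hc
  · exact le_of_mul_le_mul_right h hx

theorem norm_sum_mul_adjoint_le {X : Fin n → (H →L[ℂ] H)} {C : ℝ} (hC : 0 ≤ C)
    (h : ∀ x, ∑ i, ‖ContinuousLinearMap.adjoint (X i) x‖ ^ 2 ≤ C * ‖x‖ ^ 2) :
    ‖∑ i, X i * ContinuousLinearMap.adjoint (X i)‖ ≤ C := by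
  refine ContinuousLinearMap.opNorm_le_bound _ hC fun x => ?_
  set y := (∑ i, X i * ContinuousLinearMap.adjoint (X i)) x with hy
  have h1 : ‖y‖ * ‖y‖ ≤ C * ‖x‖ * ‖y‖ := by
    have h2 : (inner ℂ y y : ℂ) = ∑ i, inner ℂ (ContinuousLinearMap.adjoint (X i) y)
        (ContinuousLinearMap.adjoint (X i) x) := by
      conv_lhs => enter [3]; rw [hy, sum_apply]
      rw [inner_sum]
      exact Finset.sum_congr rfl fun i _ =>
        (ContinuousLinearMap.adjoint_inner_left (X i) (ContinuousLinearMap.adjoint (X i) x) y).symm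
    have h3 : ‖y‖ * ‖y‖ = ‖(inner ℂ y y : ℂ)‖ := by
      rw [inner_self_eq_norm_sq_to_K]
      simp [sq]
    rw [h3, h2]
    calc _ ≤ ∑ i, ‖ContinuousLinearMap.adjoint (X i) y‖ * ‖ContinuousLinearMap.adjoint (X i) x‖ :=
          (norm_sum_le _ _).trans (Finset.sum_le_sum fun i _ => norm_inner_le_norm _ _)
      _ ≤ √(C * ‖y‖ ^ 2) * √(C * ‖x‖ ^ 2) :=
          (Real.sum_mul_le_sqrt_mul_sqrt _ _ _).trans
            (mul_le_mul (Real.sqrt_le_sqrt (h y)) (Real.sqrt_le_sqrt (h x)) (by positivity)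
              (by positivity))
      _ = _ := by
          rw [Real.sqrt_mul hC, Real.sqrt_mul hC, Real.sqrt_sq (norm_nonneg _),
            Real.sqrt_sq (norm_nonneg _)]
          linear_combination (‖y‖ * ‖x‖) * Real.mul_self_sqrt hC
  exact le_of_mul_self_le_mul (norm_nonneg y) (by positivity) h1

theorem mem_ncBall_of_sum_adjoint_le {X : Fin n → (H →L[ℂ] H)} {C : ℝ} (hC : 0 ≤ C) (hC1 : C < 1)
    (h : ∀ x, ∑ i, ‖ContinuousLinearMap.adjoint (X i) x‖ ^ 2 ≤ C * ‖x‖ ^ 2) : X ∈ ncBall n H := by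
  change √_ < 1
  rw [Real.sqrt_lt' one_pos, one_pow]
  exact (norm_sum_mul_adjoint_le hC h).trans_lt hC1

/-- A tuple in the ball acts as a row contraction on columns of vectors. -/
theorem norm_sq_sum_apply_le_of_mem_ncBall {Y : Fin n → (H →L[ℂ] H)} (hY : Y ∈ ncBall n H)
    (x : Fin n → H) : ‖∑ i, Y i (x i)‖ ^ 2 ≤ ∑ i, ‖x i‖ ^ 2 := by
  set y := ∑ i, Y i (x i) with hy
  have hY1 : ‖∑ i, Y i * ContinuousLinearMap.adjoint (Y i)‖ ≤ 1 := by
    have : √‖∑ i, Y i * ContinuousLinearMap.adjoint (Y i)‖ < 1 := hY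
    rw [Real.sqrt_lt' one_pos, one_pow] at this
    exact this.le
  have h0 : ∑ i, ‖ContinuousLinearMap.adjoint (Y i) y‖ ^ 2 ≤ ‖y‖ ^ 2 :=
    (ncBall_sum_adjoint_le Y y).trans (mul_le_of_le_one_left (by positivity) hY1)
  have h1 : ‖y‖ * ‖y‖ ≤ √(∑ i, ‖x i‖ ^ 2) * ‖y‖ := by
    have h2 : (inner ℂ y y : ℂ) = ∑ i, inner ℂ (ContinuousLinearMap.adjoint (Y i) y) (x i) := by
      conv_lhs => enter [3]; rw [hy]
      rw [inner_sum]
      exact Finset.sum_congr rfl fun i _ =>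
        (ContinuousLinearMap.adjoint_inner_left _ _ _).symm
    have h3 : ‖y‖ * ‖y‖ = ‖(inner ℂ y y : ℂ)‖ := by
      rw [inner_self_eq_norm_sq_to_K]
      simp [sq]
    rw [h3, h2]
    calc _ ≤ ∑ i, ‖x i‖ * ‖ContinuousLinearMap.adjoint (Y i) y‖ :=
          (norm_sum_le _ _).trans (Finset.sum_le_sum fun i _ =>
            (norm_inner_le_norm _ _).trans (mul_comm _ _).le)
      _ ≤ _ := Real.sum_mul_le_sqrt_mul_sqrt _ _ _
      _ ≤ _ := mul_le_mul_of_nonneg_left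
          (Real.sqrt_le_iff.2 ⟨norm_nonneg _, h0⟩) (by positivity)
  have h4 : ‖y‖ ≤ √(∑ i, ‖x i‖ ^ 2) :=
    le_of_mul_self_le_mul (norm_nonneg y) (by positivity) h1
  rw [← Real.sq_sqrt (Finset.sum_nonneg fun i _ => sq_nonneg ‖x i‖)]
  exact pow_le_pow_left₀ (norm_nonneg _) h4 2

/-! ### The shift model -/

open Classical in
theorem orthonormal_single_comp {ι κ : Type*} {m : ι → κ} (hm : Function.Injective m) :
    Orthonormal ℂ fun i => (lp.single 2 (m i) (1 : ℂ) : lp (fun _ : κ => ℂ) 2) := by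
  rw [orthonormal_iff_ite]
  intro i j
  rw [lp.inner_single_left, lp.single_apply]
  simp [Pi.single_apply, hm.eq_iff]

/-- The left creation operator `Z_α ↦ Z_i Z_α` on the Hardy space. -/
def leftShift (i : Fin n) : HardySpace n →ₗᵢ[ℂ] HardySpace n :=
  (orthonormal_single_comp (mul_right_injective (FreeMonoid.of i))).l2Isometry

theorem leftShift_apply_of_mul (i : Fin n) (h : HardySpace n) (γ : FreeMonoid (Fin n)) :
    leftShift i h (FreeMonoid.of i * γ) = h γ := by
  classical
  have h1 := (orthonormal_single_comp
    (mul_right_injective (FreeMonoid.of i))).inner_l2Isometry_self h γ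
  rw [lp.inner_single_left] at h1
  simpa [leftShift] using h1

theorem leftShift_apply_eq_zero (i : Fin n) (h : HardySpace n) {γ : FreeMonoid (Fin n)}
    (hγ : ∀ δ, γ ≠ FreeMonoid.of i * δ) : leftShift i h γ = 0 := by
  classical
  have h1 := (orthonormal_single_comp
    (mul_right_injective (FreeMonoid.of i))).inner_l2Isometry_of_forall_eq_zero h
      (u := lp.single 2 γ (1 : ℂ)) fun α => by
        rw [lp.inner_single_left, lp.single_apply]
        simp [hγ α]
  rw [lp.inner_single_left] at h1
  simpa [leftShift] using h1

theorem adjoint_leftShift_apply (i : Fin n) (f : HardySpace n) (α : FreeMonoid (Fin n)) :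
    ContinuousLinearMap.adjoint (leftShift i).toContinuousLinearMap f α =
      f (FreeMonoid.of i * α) := by
  classical
  have h1 : (inner ℂ (lp.single 2 α (1 : ℂ)) (ContinuousLinearMap.adjoint
      (leftShift i).toContinuousLinearMap f) : ℂ) =
      inner ℂ (lp.single 2 (FreeMonoid.of i * α) (1 : ℂ)) f := by
    rw [ContinuousLinearMap.adjoint_inner_right]
    congr 1
    have := OrthogonalFamily.linearIsometry_apply_single
      (orthonormal_single_comp (mul_right_injective (FreeMonoid.of i))).orthogonalFamily
      (i := α) (1 : ℂ)
    exact this.trans (by simp)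
  rw [lp.inner_single_left, lp.inner_single_left] at h1
  simpa using h1

theorem sum_norm_sq_adjoint_leftShift_le (f : HardySpace n) :
    ∑ i, ‖ContinuousLinearMap.adjoint (leftShift i).toContinuousLinearMap f‖ ^ 2 ≤ ‖f‖ ^ 2 := by
  have hinj : Function.Injective fun p : Fin n × FreeMonoid (Fin n) => FreeMonoid.of p.1 * p.2 := by
    rintro ⟨i, α⟩ ⟨j, β⟩ h
    have h' : i :: α.toList = j :: β.toList := h
    simp only [List.cons.injEq] at h'
    exact Prod.ext h'.1 h'.2
  have hs : Summable fun p : Fin n × FreeMonoid (Fin n) => ‖f (FreeMonoid.of p.1 * p.2)‖ ^ 2 :=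
    f.summable_norm_sq.comp_injective hinj
  have h1 : ∑ i, ‖ContinuousLinearMap.adjoint (leftShift i).toContinuousLinearMap f‖ ^ 2 =
      ∑' p : Fin n × FreeMonoid (Fin n), ‖f (FreeMonoid.of p.1 * p.2)‖ ^ 2 := by
    rw [Summable.tsum_prod hs, tsum_fintype]
    refine Finset.sum_congr rfl fun i _ => ?_
    rw [HardySpace.norm_sq_eq]
    simp only [adjoint_leftShift_apply]
  rw [h1, f.norm_sq_eq]
  exact tsum_comp_le_tsum_of_inj f.summable_norm_sq (fun _ => by positivity) hinj

/-- The left creation operators scaled by `r`, transported to the isometric copy of the Hardy space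
in `H` spanned by an orthonormal family, and zero on the orthogonal complement of that copy. -/
def shiftModel {e : FreeMonoid (Fin n) → H} (he : Orthonormal ℂ e) (r : ℝ) (i : Fin n) :
    H →L[ℂ] H :=
  (r : ℂ) • (he.l2Isometry.toContinuousLinearMap ∘L (leftShift i).toContinuousLinearMap ∘L
    ContinuousLinearMap.adjoint he.l2Isometry.toContinuousLinearMap)

theorem adjoint_l2Isometry_apply_self {ι : Type*} {e : ι → H} (he : Orthonormal ℂ e)
    (f : lp (fun _ : ι => ℂ) 2) :
    ContinuousLinearMap.adjoint he.l2Isometry.toContinuousLinearMap (he.l2Isometry f) = f := by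
  refine ext_inner_left ℂ fun g => ?_
  rw [ContinuousLinearMap.adjoint_inner_right]
  exact he.l2Isometry.inner_map_map g f

theorem norm_adjoint_l2Isometry_le {ι : Type*} {e : ι → H} (he : Orthonormal ℂ e) (x : H) :
    ‖ContinuousLinearMap.adjoint he.l2Isometry.toContinuousLinearMap x‖ ≤ ‖x‖ := by
  refine (ContinuousLinearMap.le_opNorm _ _).trans (mul_le_of_le_one_left (norm_nonneg _) ?_)
  rw [LinearIsometryEquiv.norm_map]
  exact he.l2Isometry.norm_toContinuousLinearMap_le

theorem shiftModel_mem_ncBall {e : FreeMonoid (Fin n) → H} (he : Orthonormal ℂ e) {r : ℝ}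
    (hr0 : 0 ≤ r) (hr1 : r < 1) : shiftModel he r ∈ ncBall n H := by
  refine mem_ncBall_of_sum_adjoint_le (C := r ^ 2) (by positivity) (by nlinarith) fun x => ?_
  have h1 : ∀ i, ‖ContinuousLinearMap.adjoint (shiftModel he r i) x‖ ^ 2 = r ^ 2 *
      ‖ContinuousLinearMap.adjoint (leftShift i).toContinuousLinearMap
        (ContinuousLinearMap.adjoint he.l2Isometry.toContinuousLinearMap x)‖ ^ 2 := fun i => by
    rw [shiftModel, LinearIsometryEquiv.map_smulₛₗ, ContinuousLinearMap.adjoint_comp,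
      ContinuousLinearMap.adjoint_comp, ContinuousLinearMap.adjoint_adjoint, smul_apply, norm_smul,
      mul_pow]
    congr 1
    · simp
    · exact congrArg (· ^ 2) (he.l2Isometry.norm_map _)
  simp only [h1]
  rw [← Finset.mul_sum]
  exact mul_le_mul_of_nonneg_left ((sum_norm_sq_adjoint_leftShift_le _).trans
    (pow_le_pow_left₀ (norm_nonneg _) (norm_adjoint_l2Isometry_le he x) 2)) (by positivity)

theorem lift_leftShift_apply_mul (α γ : FreeMonoid (Fin n)) (h : HardySpace n) :
    FreeMonoid.lift (fun i => (leftShift i).toContinuousLinearMap) α h (α * γ) = h γ := by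
  induction α using FreeMonoid.inductionOn' generalizing γ with
  | one => simp
  | of_mul i α ih =>
    rw [map_mul, FreeMonoid.lift_eval_of, mul_assoc]
    exact (leftShift_apply_of_mul _ _ _).trans (ih γ)

theorem lift_leftShift_apply_eq_zero {α γ : FreeMonoid (Fin n)} (hγ : ∀ δ, γ ≠ α * δ)
    (h : HardySpace n) :
    FreeMonoid.lift (fun i => (leftShift i).toContinuousLinearMap) α h γ = 0 := by
  induction α using FreeMonoid.inductionOn' generalizing γ with
  | one => exact absurd (one_mul γ).symm (hγ γ)
  | of_mul i α ih =>
    rw [map_mul, FreeMonoid.lift_eval_of]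
    by_cases h1 : ∃ δ, γ = FreeMonoid.of i * δ
    · obtain ⟨δ, rfl⟩ := h1
      refine (leftShift_apply_of_mul _ _ _).trans (ih fun δ' h2 => hγ δ' ?_)
      rw [h2, mul_assoc]
    · exact leftShift_apply_eq_zero _ _ (not_exists.1 h1)

theorem lift_shiftModel_word_apply {e : FreeMonoid (Fin n) → H} (he : Orthonormal ℂ e) (r : ℝ)
    {k : ℕ} (w : Fin k → Fin n) (h : HardySpace n) :
    FreeMonoid.lift (shiftModel he r) (word w) (he.l2Isometry h) = (r : ℂ) ^ k •
      he.l2Isometry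
        (FreeMonoid.lift (fun i => (leftShift i).toContinuousLinearMap) (word w) h) := by
  have h1 : ∀ α, FreeMonoid.lift (fun i => he.l2Isometry.toContinuousLinearMap ∘L
      (leftShift i).toContinuousLinearMap ∘L
        ContinuousLinearMap.adjoint he.l2Isometry.toContinuousLinearMap) α (he.l2Isometry h) =
      he.l2Isometry (FreeMonoid.lift (fun i => (leftShift i).toContinuousLinearMap) α h) := by
    intro α
    induction α using FreeMonoid.inductionOn' with
    | one => simp
    | of_mul i α ih =>
      rw [map_mul, map_mul, FreeMonoid.lift_eval_of, FreeMonoid.lift_eval_of,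
        mul_apply_eq_comp, ih]
      simp [adjoint_l2Isometry_apply_self]
  rw [← h1, ← smul_apply, ← lift_smul_word]
  rfl

/-- In the shift model a free holomorphic function acts as the Cauchy product by its dilation. -/
theorem inner_eval_shiftModel {e : FreeMonoid (Fin n) → H} (he : Orthonormal ℂ e) {r : ℝ}
    (hr0 : 0 ≤ r) (hr1 : r < 1) (f : FreeHolomorphic n) (h : HardySpace n)
    (γ : FreeMonoid (Fin n)) :
    (inner ℂ (e γ) (f.eval (shiftModel he r) (he.l2Isometry h)) : ℂ) =
      cauchyProduct (fun α => (r : ℂ) ^ α.toList.length * f.coeff α) h γ := by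
  set S := fun i : Fin n => (leftShift i).toContinuousLinearMap with hS
  have h1 := (((f.summable_of_mem_ncBall _ (shiftModel_mem_ncBall he hr0 hr1)).hasSum.mapL
    (ContinuousLinearMap.apply ℂ H (he.l2Isometry h))).mapL (innerSL ℂ (e γ)))
  refine h1.unique ?_
  have h2 : ∀ k, innerSL ℂ (e γ) (ContinuousLinearMap.apply ℂ H (he.l2Isometry h)
      (f.homogeneousPart k (shiftModel he r))) =
      ∑ w : Fin k → Fin n, (r : ℂ) ^ k * f.coeff (word w) * FreeMonoid.lift S (word w) h γ := by
    intro k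
    simp only [FreeHolomorphic.homogeneousPart, map_sum, map_smul, ContinuousLinearMap.apply_apply,
      lift_shiftModel_word_apply, innerSL_apply_apply, he.inner_l2Isometry_self, smul_eq_mul]
    exact Finset.sum_congr rfl fun w _ => by ring
  simp only [h2]
  have h3 : cauchyProduct (fun α => (r : ℂ) ^ α.toList.length * f.coeff α) h γ =
      ∑ k ∈ Finset.range (γ.toList.length + 1), ∑ w : Fin k → Fin n,
        (r : ℂ) ^ k * f.coeff (word w) * FreeMonoid.lift S (word w) h γ := by
    rw [cauchyProduct, Finset.Nat.sum_antidiagonal_eq_sum_range_succ_mk]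
    refine Finset.sum_congr rfl fun k hk => ?_
    have hk' : k ≤ γ.toList.length := Nat.lt_succ_iff.1 (Finset.mem_range.1 hk)
    obtain ⟨w, hw⟩ := exists_word_eq (n := n) (k := k) (FreeMonoid.ofList (γ.toList.take k))
      (by simpa using hk')
    have hγ : γ = word w * FreeMonoid.ofList (γ.toList.drop k) := by
      rw [hw]
      exact (List.take_append_drop k γ.toList).symm
    -- Only the prefix of `γ` of length `k` contributes in degree `k`.
    rw [Finset.sum_eq_single w]
    · conv_rhs => rw [hγ, lift_leftShift_apply_mul]
      simp only [← hw, length_word]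
    · intro v _ hv
      rw [lift_leftShift_apply_eq_zero, mul_zero]
      intro δ hδ
      refine hv (word_injective ?_)
      rw [hδ] at hγ
      exact List.append_inj_left hγ ((length_word v).trans (length_word w).symm)
    · simp
  rw [h3]
  refine hasSum_sum_of_ne_finset_zero fun k hk => Finset.sum_eq_zero fun w _ => ?_
  rw [lift_leftShift_apply_eq_zero, mul_zero]
  rintro δ rfl
  refine hk (Finset.mem_range.2 ?_)
  have : (word w * δ).toList.length = k + δ.toList.length := by
    rw [FreeMonoid.toList_mul, List.length_append, length_word]
  omega

/-! ### Left multiplication by the components of a self-map -/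

theorem exists_orthonormal_freeMonoid (n : ℕ) (hH : ¬ FiniteDimensional ℂ H) :
    ∃ e : FreeMonoid (Fin n) → H, Orthonormal ℂ e := by
  obtain ⟨w, b, -⟩ := exists_hilbertBasis ℂ H
  have hw : Infinite w := by
    rw [← not_finite_iff_infinite]
    intro hw
    have := Fintype.ofFinite w
    exact hH (Module.Basis.finiteDimensional_of_finite b.toOrthonormalBasis.toBasis)
  have hcount : Countable (FreeMonoid (Fin n)) := inferInstanceAs (Countable (List (Fin n)))
  obtain ⟨m, hm⟩ := hcount.exists_injective_nat
  exact ⟨_, b.orthonormal.comp _ ((Infinite.natEmbedding w).injective.comp hm)⟩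

/-- The components of a self-map of the ball multiply columns of the Hardy space contractively.
Evaluation at the dilated shift model gives this for the dilations of the components. Each
coefficient of the product is a polynomial in the dilation parameter, so the parameter can be
sent to one in every finite set of coefficients. -/
theorem sum_norm_sq_sum_cauchyProduct_le {e : FreeMonoid (Fin n) → H} (he : Orthonormal ℂ e)
    {φ : Fin n → FreeHolomorphic n} (hφ : IsFreeHolomorphicSelfMap H φ) (h : Fin n → HardySpace n)
    (s : Finset (FreeMonoid (Fin n))) :
    ∑ γ ∈ s, ‖∑ i, cauchyProduct (φ i).coeff (h i) γ‖ ^ 2 ≤ ∑ i, ‖h i‖ ^ 2 := by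
  set F : ℝ → ℝ := fun r => ∑ γ ∈ s, ‖∑ i,
    cauchyProduct (fun α => (r : ℂ) ^ α.toList.length * (φ i).coeff α) (h i) γ‖ ^ 2 with hF
  have hcont : Continuous F := by
    simp only [hF, cauchyProduct]
    fun_prop
  have hF1 : F 1 = ∑ γ ∈ s, ‖∑ i, cauchyProduct (φ i).coeff (h i) γ‖ ^ 2 := by
    simp [hF]
  have hev : ∀ᶠ r in 𝓝[<] (1 : ℝ), F r ≤ ∑ i, ‖h i‖ ^ 2 := by
    filter_upwards [Ioo_mem_nhdsLT (zero_lt_one' ℝ)] with r hr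
    have h1 := norm_sq_sum_apply_le_of_mem_ncBall
      (hφ _ (shiftModel_mem_ncBall he hr.1.le hr.2)) fun i => he.l2Isometry (h i)
    simp only [LinearIsometry.norm_map] at h1
    refine le_trans ?_ ((he.sum_inner_products_le _ (s := s)).trans h1)
    simp only [hF, inner_sum, inner_eval_shiftModel he hr.1.le hr.2]
    exact le_rfl
  rw [← hF1]
  exact le_of_tendsto (hcont.tendsto 1 |>.mono_left nhdsWithin_le_nhds) hev

/-- Left multiplication on the Hardy space by a contractive multiplier. -/
def leftMulCLM (a : FreeMonoid (Fin n) → ℂ)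
    (ha : ∀ (h : HardySpace n) (s : Finset (FreeMonoid (Fin n))),
      ∑ γ ∈ s, ‖cauchyProduct a h γ‖ ^ 2 ≤ ‖h‖ ^ 2) : HardySpace n →L[ℂ] HardySpace n :=
  LinearMap.mkContinuous
    { toFun := fun h => ⟨cauchyProduct a h, memℓp_gen' (C := ‖h‖ ^ 2) fun s => by
        simpa using ha h s⟩
      map_add' := fun f g => lp.ext (cauchyProduct_add_right a f g)
      map_smul' := fun c f => lp.ext (cauchyProduct_smul_right a f c) }
    1 fun h => by
      rw [one_mul]
      exact lp.norm_le_of_forall_sum_le (by norm_num) (norm_nonneg _) fun s => by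
        simpa using ha h s

theorem leftMulCLM_apply (a : FreeMonoid (Fin n) → ℂ) (ha) (h : HardySpace n) :
    (leftMulCLM a ha h : FreeMonoid (Fin n) → ℂ) = cauchyProduct a h := rfl

open Classical in
/-- The components of a self-map of the ball define a row contraction on the Hardy space by left
multiplication, and the constant function one is a joint eigenvector of the adjoints. -/
theorem exists_rowContraction_of_selfMap {e : FreeMonoid (Fin n) → H} (he : Orthonormal ℂ e)
    {φ : Fin n → FreeHolomorphic n} (hφ : IsFreeHolomorphicSelfMap H φ) :
    ∃ T : Fin n → (HardySpace n →L[ℂ] HardySpace n),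
      (∀ i h, (T i h : FreeMonoid (Fin n) → ℂ) = cauchyProduct (φ i).coeff h) ∧
      (∀ x, ∑ i, ‖ContinuousLinearMap.adjoint (T i) x‖ ^ 2 ≤ ‖x‖ ^ 2) ∧
      ∀ i, ContinuousLinearMap.adjoint (T i) (lp.single 2 1 (1 : ℂ)) =
        (starRingEnd ℂ) ((φ i).coeff 1) • (lp.single 2 1 (1 : ℂ) : HardySpace n) := by
  have ha : ∀ i (h : HardySpace n) (s : Finset (FreeMonoid (Fin n))),
      ∑ γ ∈ s, ‖cauchyProduct (φ i).coeff h γ‖ ^ 2 ≤ ‖h‖ ^ 2 := fun i h s => by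
    let p : Fin n → HardySpace n := fun j => if j = i then h else 0
    have hp : p i = h := if_pos rfl
    have hp' : ∀ j, j ≠ i → p j = 0 := fun j hj => if_neg hj
    have h1 := sum_norm_sq_sum_cauchyProduct_le he hφ p s
    have h2 : ∀ γ, ∑ j, cauchyProduct (φ j).coeff (p j) γ = cauchyProduct (φ i).coeff h γ :=
      fun γ => by
        rw [Finset.sum_eq_single_of_mem i (Finset.mem_univ i), hp]
        intro j _ hj
        simp [hp' j hj, cauchyProduct]
    have h3 : ∑ j, ‖p j‖ ^ 2 = ‖h‖ ^ 2 := by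
      rw [Finset.sum_eq_single_of_mem i (Finset.mem_univ i), hp]
      intro j _ hj
      simp [hp' j hj]
    simpa only [h2, h3] using h1
  have hrow : ∀ h : Fin n → HardySpace n,
      ‖∑ i, leftMulCLM (φ i).coeff (ha i) (h i)‖ ≤ √(∑ i, ‖h i‖ ^ 2) := fun h => by
    refine lp.norm_le_of_forall_sum_le (by norm_num) (Real.sqrt_nonneg _) fun s => ?_
    have h1 := sum_norm_sq_sum_cauchyProduct_le he hφ h s
    have h2 : √(∑ i, ‖h i‖ ^ 2) ^ 2 = ∑ i, ‖h i‖ ^ 2 :=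
      Real.sq_sqrt (Finset.sum_nonneg fun _ _ => by positivity)
    have h3 : ∀ γ, (∑ i, leftMulCLM (φ i).coeff (ha i) (h i) : HardySpace n) γ =
        ∑ i, cauchyProduct (φ i).coeff (h i) γ := fun γ => by
      rw [lp.coeFn_sum]
      exact Finset.sum_apply γ _ _
    simp only [h3, ENNReal.toReal_ofNat, Real.rpow_ofNat, h2]
    exact h1
  refine ⟨fun i => leftMulCLM (φ i).coeff (ha i), fun i h => rfl, fun x => ?_, fun i => ?_⟩
  · set S := fun i => leftMulCLM (φ i).coeff (ha i) with hS
    set q := √(∑ i, ‖ContinuousLinearMap.adjoint (S i) x‖ ^ 2) with hq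
    have hsq : q ^ 2 = ∑ i, ‖ContinuousLinearMap.adjoint (S i) x‖ ^ 2 :=
      Real.sq_sqrt (Finset.sum_nonneg fun _ _ => by positivity)
    have h1 : (inner ℂ x (∑ i, S i (ContinuousLinearMap.adjoint (S i) x)) : ℂ) =
        ((q ^ 2 : ℝ) : ℂ) := by
      rw [hsq, inner_sum]
      push_cast
      refine Finset.sum_congr rfl fun i _ => ?_
      rw [← ContinuousLinearMap.adjoint_inner_left, inner_self_eq_norm_sq_to_K]
      rfl
    have h2 := norm_inner_le_norm (𝕜 := ℂ) x (∑ i, S i (ContinuousLinearMap.adjoint (S i) x))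
    rw [h1, Complex.norm_real, Real.norm_of_nonneg (by positivity)] at h2
    have h3 : q * q ≤ ‖x‖ * q := by
      rw [← sq]
      exact h2.trans (mul_le_mul_of_nonneg_left (hrow _) (norm_nonneg _))
    have h4 : q ≤ ‖x‖ := le_of_mul_self_le_mul (Real.sqrt_nonneg _) (norm_nonneg x) h3
    rw [← hsq]
    exact pow_le_pow_left₀ (Real.sqrt_nonneg _) h4 2
  · refine ext_inner_right ℂ fun h => ?_
    rw [ContinuousLinearMap.adjoint_inner_left, inner_smul_left, lp.inner_single_left,
      lp.inner_single_left, leftMulCLM_apply, cauchyProduct_one]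
    simp [mul_comm]

/-! ### The composition operator -/

open Classical in
/-- The operator `f ↦ f(T) Ω` on the Hardy space. It is obtained as the adjoint of
`x ↦ (⟪T_α Ω, x⟫)_α`, so that its norm is controlled by `summable_and_tsum_norm_sq_inner_le`. -/
theorem exists_clm_single_eq_lift_apply {T : Fin n → (K →L[ℂ] K)}
    (hT : ∀ x, ∑ i, ‖ContinuousLinearMap.adjoint (T i) x‖ ^ 2 ≤ ‖x‖ ^ 2) {Ω : K} (hΩ : ‖Ω‖ = 1)
    {c : EuclideanSpace ℂ (Fin n)} (hc : ‖c‖ < 1)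
    (hTΩ : ∀ i, ContinuousLinearMap.adjoint (T i) Ω = c i • Ω) :
    ∃ C : HardySpace n →L[ℂ] K, ‖C‖ ≤ √((1 + ‖c‖) / (1 - ‖c‖)) ∧
      ∀ α, C (lp.single 2 α (1 : ℂ)) = FreeMonoid.lift T α Ω := by
  have hb := summable_and_tsum_norm_sq_inner_le hT hΩ hc hTΩ
  have hM : 0 ≤ (1 + ‖c‖) / (1 - ‖c‖) :=
    div_nonneg (by positivity) (by linarith)
  have hmem : ∀ x, Memℓp (fun α => (inner ℂ (FreeMonoid.lift T α Ω) x : ℂ)) 2 := fun x =>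
    memℓp_gen (by simpa using (hb x).1)
  let L : K →ₗ[ℂ] HardySpace n :=
    { toFun := fun x => ⟨fun α => inner ℂ (FreeMonoid.lift T α Ω) x, hmem x⟩
      map_add' := fun x y => lp.ext (funext fun α => inner_add_right _ _ _)
      map_smul' := fun r x => lp.ext (funext fun α => inner_smul_right _ _ _) }
  have hL : ∀ x, ‖L x‖ ≤ √((1 + ‖c‖) / (1 - ‖c‖)) * ‖x‖ := fun x => by
    refine le_of_sq_le_sq ?_ (by positivity)
    rw [mul_pow, Real.sq_sqrt hM, HardySpace.norm_sq_eq]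
    exact (hb x).2
  refine ⟨ContinuousLinearMap.adjoint (L.mkContinuous _ hL), ?_, fun α => ?_⟩
  · rw [LinearIsometryEquiv.norm_map]
    exact L.mkContinuous_norm_le (Real.sqrt_nonneg _) hL
  · refine ext_inner_right ℂ fun x => ?_
    rw [ContinuousLinearMap.adjoint_inner_left, lp.inner_single_left]
    simp [L]

/-- If `T i` is left multiplication by `φ i`, then `T_α f` is the product `φ_α f` on the ball. -/
theorem HardySpace.eval_lift_apply {φ : Fin n → FreeHolomorphic n}
    {T : Fin n → (HardySpace n →L[ℂ] HardySpace n)}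
    (hTφ : ∀ i h, (T i h : FreeMonoid (Fin n) → ℂ) = cauchyProduct (φ i).coeff h)
    {X : Fin n → (H →L[ℂ] H)} (hX : X ∈ ncBall n H) (α : FreeMonoid (Fin n)) (f : HardySpace n) :
    (FreeMonoid.lift T α f).toFreeHolomorphic.eval X =
      FreeMonoid.lift (fun i => (φ i).eval X) α * f.toFreeHolomorphic.eval X := by
  induction α using FreeMonoid.inductionOn' with
  | one => simp
  | of_mul i α ih =>
    rw [map_mul, map_mul, FreeMonoid.lift_eval_of, FreeMonoid.lift_eval_of, mul_assoc, ← ih]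
    exact FreeHolomorphic.eval_mul_of_coeff_eq (hTφ i _) hX

open Classical in
/-- Evaluation at a point of the ball is continuous on the Hardy space, so that the identity
`(C f)(X) = f(φ(X))` need only be verified on monomials. -/
theorem isCompositionOperator_of_apply_single {φ : Fin n → FreeHolomorphic n}
    (hφ : IsFreeHolomorphicSelfMap H φ) {T : Fin n → (HardySpace n →L[ℂ] HardySpace n)}
    (hTφ : ∀ i h, (T i h : FreeMonoid (Fin n) → ℂ) = cauchyProduct (φ i).coeff h)
    {C : HardySpace n →L[ℂ] HardySpace n}
    (hC : ∀ α, C (lp.single 2 α (1 : ℂ)) = FreeMonoid.lift T α (lp.single 2 1 (1 : ℂ))) :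
    IsCompositionOperator H φ C := by
  intro f X hX
  have h : HardySpace.evalCLM X hX ∘L C = HardySpace.evalCLM _ (hφ X hX) := by
    refine lp.ext_continuousLinearMap (by norm_num) fun α => ?_
    ext1
    simp only [ContinuousLinearMap.comp_apply, lp.singleContinuousLinearMap_apply, hC,
      HardySpace.evalCLM_apply, HardySpace.eval_lift_apply hTφ hX, HardySpace.eval_single,
      map_one, mul_one]
  exact congrArg (fun A => A f) h

/-- Elements of the Hardy space are determined by their values on the ball: their coefficients are
read off at the dilated shift model. -/
theorem HardySpace.eq_of_eval_eq {e : FreeMonoid (Fin n) → H} (he : Orthonormal ℂ e)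
    {f g : HardySpace n} (h : ∀ X ∈ ncBall n H,
      f.toFreeHolomorphic.eval X = g.toFreeHolomorphic.eval X) : f = g := by
  classical
  have hr0 : (0 : ℝ) ≤ 1 / 2 := by norm_num
  have hr1 : (1 / 2 : ℝ) < 1 := by norm_num
  have h1 : ∀ (a : FreeMonoid (Fin n) → ℂ) γ,
      cauchyProduct a (lp.single 2 1 (1 : ℂ) : HardySpace n) γ = a γ := by
    intro a γ
    rw [cauchyProduct, Finset.sum_eq_single (γ.toList.length, 0)]
    · simp [show FreeMonoid.ofList ([] : List (Fin n)) = 1 from rfl]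
    · rintro ⟨j, k⟩ hp hne
      rw [Finset.HasAntidiagonal.mem_antidiagonal] at hp
      have hk : FreeMonoid.ofList (γ.toList.drop j) ≠ 1 := by
        intro h0
        have h2 : γ.toList.drop j = [] := h0
        rw [List.drop_eq_nil_iff] at h2
        exact hne (by ext <;> simp at * <;> omega)
      rw [lp.single_apply_ne _ _ _ hk, mul_zero]
    · simp
  refine lp.ext (funext fun γ => ?_)
  have h2 := inner_eval_shiftModel he hr0 hr1 f.toFreeHolomorphic (lp.single 2 1 (1 : ℂ)) γ
  rw [h _ (shiftModel_mem_ncBall he hr0 hr1), inner_eval_shiftModel he hr0 hr1, h1, h1] at h2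
  exact (mul_left_cancel₀ (by simp) h2).symm

/-! ### Scalar points and kernel vectors -/

theorem FreeHolomorphic.eval_smul_one (f : FreeHolomorphic n) {z : EuclideanSpace ℂ (Fin n)}
    (hz : ‖z‖ < 1) :
    f.eval (fun i => z i • (1 : H →L[ℂ] H)) = f.eval (fun i => z i) • (1 : H →L[ℂ] H) := by
  have h1 : ∀ α : FreeMonoid (Fin n), FreeMonoid.lift (fun i => z i • (1 : H →L[ℂ] H)) α =
      FreeMonoid.lift (fun i => z i) α • (1 : H →L[ℂ] H) := by
    intro α
    induction α using FreeMonoid.inductionOn' with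
    | one => simp
    | of_mul i α ih => simp [ih, smul_smul, mul_comm]
  have h2 : ∀ k, f.homogeneousPart k (fun i => z i • (1 : H →L[ℂ] H)) =
      f.homogeneousPart k (fun i => z i) • (1 : H →L[ℂ] H) := fun k => by
    simp only [FreeHolomorphic.homogeneousPart, h1, Finset.sum_smul, smul_assoc]
  rw [FreeHolomorphic.eval, tsum_congr h2]
  exact ((f.summable_of_mem_ball z hz).hasSum.smul_const (1 : H →L[ℂ] H)).tsum_eq

theorem adjoint_smul_one_apply (c : ℂ) (x : H) :
    ContinuousLinearMap.adjoint (c • (1 : H →L[ℂ] H)) x = (starRingEnd ℂ) c • x := by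
  have h1 : ContinuousLinearMap.adjoint (1 : H →L[ℂ] H) = 1 := ContinuousLinearMap.adjoint_id
  rw [LinearIsometryEquiv.map_smulₛₗ, h1]
  rfl

theorem smul_one_mem_ncBall {z : EuclideanSpace ℂ (Fin n)} (hz : ‖z‖ < 1) :
    (fun i => z i • (1 : H →L[ℂ] H)) ∈ ncBall n H := by
  refine mem_ncBall_of_sum_adjoint_le (C := ‖z‖ ^ 2) (by positivity)
    (by nlinarith [norm_nonneg z]) fun x => le_of_eq ?_
  simp [adjoint_smul_one_apply, norm_smul, mul_pow, EuclideanSpace.norm_sq_eq, Finset.sum_mul]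

theorem norm_lt_one_of_smul_one_mem_ncBall [Nontrivial H] {z : EuclideanSpace ℂ (Fin n)}
    (hz : (fun i => z i • (1 : H →L[ℂ] H)) ∈ ncBall n H) : ‖z‖ < 1 := by
  obtain ⟨x, hx⟩ := exists_norm_eq H zero_le_one
  have h1 := ncBall_sum_adjoint_le (fun i => z i • (1 : H →L[ℂ] H)) x
  have h2 : √‖∑ i, (z i • (1 : H →L[ℂ] H)) *
      ContinuousLinearMap.adjoint (z i • (1 : H →L[ℂ] H))‖ < 1 := hz
  rw [Real.sqrt_lt' one_pos, one_pow] at h2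
  simp only [adjoint_smul_one_apply, norm_smul, RCLike.norm_conj, hx, mul_one, one_pow,
    ← EuclideanSpace.norm_sq_eq] at h1
  exact (sq_lt_one_iff₀ (norm_nonneg _)).1 (h1.trans_lt h2)

theorem norm_scalarRep_lt_one [Nontrivial H] {φ : Fin n → FreeHolomorphic n}
    (hφ : IsFreeHolomorphicSelfMap H φ) {z : EuclideanSpace ℂ (Fin n)} (hz : ‖z‖ < 1) :
    ‖scalarRep φ z‖ < 1 := by
  refine norm_lt_one_of_smul_one_mem_ncBall (H := H) ?_
  have h1 := hφ _ (smul_one_mem_ncBall hz)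
  simp only [FreeHolomorphic.eval_smul_one _ hz] at h1
  exact h1

theorem scalarRep_zero_apply (φ : Fin n → FreeHolomorphic n) (i : Fin n) :
    scalarRep φ 0 i = (φ i).coeff 1 := by
  change (φ i).eval _ = _
  rw [FreeHolomorphic.eval, tsum_eq_single 0]
  · simp [FreeHolomorphic.homogeneousPart, word_elim0]
  · intro k hk
    obtain ⟨k, rfl⟩ := Nat.exists_eq_succ_of_ne_zero hk
    refine Finset.sum_eq_zero fun w _ => ?_
    rw [← Fin.cons_self_tail w, word_cons, map_mul, FreeMonoid.lift_eval_of]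
    simp

theorem memℓp_kernel {z : EuclideanSpace ℂ (Fin n)} (hz : ‖z‖ < 1) :
    Memℓp (fun α : FreeMonoid (Fin n) => (starRingEnd ℂ) (FreeMonoid.lift (fun i => z i) α)) 2 := by
  refine memℓp_gen ?_
  have hs : Summable fun k => (‖z‖ ^ 2) ^ k :=
    summable_geometric_of_lt_one (by positivity) (by nlinarith [norm_nonneg z])
  refine (summable_and_tsum_le_of_levels (B := ∑' k, (‖z‖ ^ 2) ^ k) (fun α => by positivity)
    fun N => ?_).1
  simp only [ENNReal.toReal_ofNat, Real.rpow_ofNat, RCLike.norm_conj, sum_norm_word_sq]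
  refine le_trans (le_of_eq ?_) (hs.sum_le_tsum (Finset.range N) fun k _ => by positivity)
  exact Finset.sum_congr rfl fun k _ => by ring

/-- The reproducing kernel vector of the Hardy space at a scalar point of the ball. -/
def kernelVector {z : EuclideanSpace ℂ (Fin n)} (hz : ‖z‖ < 1) : HardySpace n :=
  ⟨_, memℓp_kernel hz⟩

theorem inner_kernelVector {z : EuclideanSpace ℂ (Fin n)} (hz : ‖z‖ < 1) (f : HardySpace n) :
    (inner ℂ (kernelVector hz) f : ℂ) = f.toFreeHolomorphic.eval (fun i => z i) := by
  have h1 := lp.hasSum_inner (𝕜 := ℂ) (kernelVector hz) f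
  have h2 : ∀ α, (inner ℂ (kernelVector hz α) (f α) : ℂ) =
      f α * FreeMonoid.lift (fun i => z i) α := fun α => by
    simp [kernelVector]
  simp only [h2] at h1
  rw [← (wordEquiv n).hasSum_iff] at h1
  rw [← (h1.sigma fun k => hasSum_fintype _).tsum_eq]
  rfl

theorem norm_sq_kernelVector {z : EuclideanSpace ℂ (Fin n)} (hz : ‖z‖ < 1) :
    ‖kernelVector hz‖ ^ 2 = (1 - ‖z‖ ^ 2)⁻¹ := by
  have h1 := inner_kernelVector hz (kernelVector hz)
  rw [inner_self_eq_norm_sq_to_K, FreeHolomorphic.eval] at h1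
  have h2 : ∀ k, (kernelVector hz).toFreeHolomorphic.homogeneousPart k (fun i => z i) =
      (((‖z‖ ^ 2) ^ k : ℝ) : ℂ) := fun k => by
    rw [← pow_mul, mul_comm 2 k, pow_mul, ← sum_norm_word_sq]
    push_cast
    refine Finset.sum_congr rfl fun w _ => ?_
    exact Complex.conj_mul' _
  simp only [h2] at h1
  rw [← Complex.ofReal_tsum, tsum_geometric_of_lt_one (by positivity)
    (by nlinarith [norm_nonneg z])] at h1
  exact Complex.ofReal_injective ((Complex.ofReal_pow _ _).trans h1)

/-- The adjoint of a composition operator maps the kernel vector at `z` to the one at `φ(z)`. -/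
theorem IsCompositionOperator.adjoint_kernelVector [Nontrivial H] {φ : Fin n → FreeHolomorphic n}
    (hφ : IsFreeHolomorphicSelfMap H φ) {C : HardySpace n →L[ℂ] HardySpace n}
    (hC : IsCompositionOperator H φ C) {z : EuclideanSpace ℂ (Fin n)} (hz : ‖z‖ < 1) :
    ContinuousLinearMap.adjoint C (kernelVector hz) =
      kernelVector (norm_scalarRep_lt_one hφ hz) := by
  refine ext_inner_right ℂ fun f => ?_
  rw [ContinuousLinearMap.adjoint_inner_left, inner_kernelVector, inner_kernelVector]
  have h1 := hC f _ (smul_one_mem_ncBall hz)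
  simp only [FreeHolomorphic.eval_smul_one _ hz] at h1
  have h2 := f.toFreeHolomorphic.eval_smul_one (H := H) (norm_scalarRep_lt_one hφ hz)
  exact smul_left_injective ℂ (one_ne_zero (α := H →L[ℂ] H)) (h1.trans h2)

theorem IsCompositionOperator.sqrt_div_le_norm [Nontrivial H] {φ : Fin n → FreeHolomorphic n}
    (hφ : IsFreeHolomorphicSelfMap H φ) {C : HardySpace n →L[ℂ] HardySpace n}
    (hC : IsCompositionOperator H φ C) {z : EuclideanSpace ℂ (Fin n)} (hz : ‖z‖ < 1) :
    √((1 - ‖z‖ ^ 2) / (1 - ‖scalarRep φ z‖ ^ 2)) ≤ ‖C‖ := by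
  have hz1 : 0 < 1 - ‖z‖ ^ 2 := by nlinarith [norm_nonneg z]
  have h1 := (ContinuousLinearMap.adjoint C).le_opNorm (kernelVector hz)
  rw [hC.adjoint_kernelVector hφ hz, LinearIsometryEquiv.norm_map] at h1
  have h2 := pow_le_pow_left₀ (norm_nonneg _) h1 2
  rw [mul_pow, norm_sq_kernelVector, norm_sq_kernelVector, ← div_eq_mul_inv, le_div_iff₀ hz1] at h2
  refine Real.sqrt_le_iff.2 ⟨norm_nonneg _, ?_⟩
  rw [div_eq_inv_mul]
  exact h2

end

theorem mainTheorem1 (n : ℕ) (hn : 1 ≤ n)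
    (H : Type*) [NormedAddCommGroup H] [InnerProductSpace ℂ H] [CompleteSpace H]
    (hH : ¬ FiniteDimensional ℂ H)
    (φ : Fin n → FreeHolomorphic n) (hφ : IsFreeHolomorphicSelfMap H φ) :
    (∃! C : HardySpace n →L[ℂ] HardySpace n, IsCompositionOperator H φ C) ∧
    ∀ C : HardySpace n →L[ℂ] HardySpace n, IsCompositionOperator H φ C →
      BddAbove (Set.range fun z : Metric.ball (0 : EuclideanSpace ℂ (Fin n)) 1 =>
        √((1 - ‖z.1‖ ^ 2) / (1 - ‖scalarRep φ z.1‖ ^ 2))) ∧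
      1 / √(1 - ‖scalarRep φ 0‖ ^ 2) ≤
        (⨆ z : Metric.ball (0 : EuclideanSpace ℂ (Fin n)) 1,
          √((1 - ‖z.1‖ ^ 2) / (1 - ‖scalarRep φ z.1‖ ^ 2))) ∧
      (⨆ z : Metric.ball (0 : EuclideanSpace ℂ (Fin n)) 1,
          √((1 - ‖z.1‖ ^ 2) / (1 - ‖scalarRep φ z.1‖ ^ 2))) ≤ ‖C‖ ∧
      ‖C‖ ≤ √((1 + ‖scalarRep φ 0‖) / (1 - ‖scalarRep φ 0‖)) := by
  classical
  obtain ⟨e, he⟩ := exists_orthonormal_freeMonoid n hH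
  have hnt : Nontrivial H := by
    by_contra hnt
    rw [not_nontrivial_iff_subsingleton] at hnt
    exact hH inferInstance
  obtain ⟨T, hTφ, hT, hTΩ⟩ := exists_rowContraction_of_selfMap he hφ
  set c : EuclideanSpace ℂ (Fin n) :=
    WithLp.toLp 2 fun i => (starRingEnd ℂ) ((φ i).coeff 1) with hc
  have hcφ : ‖c‖ = ‖scalarRep φ 0‖ := by
    simp [EuclideanSpace.norm_eq, hc, scalarRep_zero_apply]
  have h0 : ‖(0 : EuclideanSpace ℂ (Fin n))‖ < 1 := by simp
  have hφ0 := norm_scalarRep_lt_one hφ h0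
  obtain ⟨C₀, hC₀norm, hC₀⟩ := exists_clm_single_eq_lift_apply hT
    (by rw [lp.norm_single (by norm_num), norm_one]) (hcφ.trans_lt hφ0) hTΩ
  have hcomp := isCompositionOperator_of_apply_single hφ hTφ hC₀
  have huniq : ∀ C, IsCompositionOperator H φ C → C = C₀ := fun C hC =>
    ContinuousLinearMap.ext fun f => HardySpace.eq_of_eval_eq he fun X hX => by
      rw [hC f X hX, hcomp f X hX]
  refine ⟨⟨C₀, hcomp, huniq⟩, fun C hC => ?_⟩
  have hle : ∀ z : Metric.ball (0 : EuclideanSpace ℂ (Fin n)) 1,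
      √((1 - ‖z.1‖ ^ 2) / (1 - ‖scalarRep φ z.1‖ ^ 2)) ≤ ‖C‖ := fun z =>
    hC.sqrt_div_le_norm hφ (mem_ball_zero_iff.1 z.2)
  have hbdd : BddAbove (Set.range fun z : Metric.ball (0 : EuclideanSpace ℂ (Fin n)) 1 =>
      √((1 - ‖z.1‖ ^ 2) / (1 - ‖scalarRep φ z.1‖ ^ 2))) :=
    ⟨‖C‖, Set.forall_mem_range.2 hle⟩
  have hne : Nonempty (Metric.ball (0 : EuclideanSpace ℂ (Fin n)) 1) := ⟨⟨0, by simp⟩⟩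
  refine ⟨hbdd, ?_, ciSup_le hle, ?_⟩
  · refine le_trans (le_of_eq ?_) (le_ciSup hbdd ⟨0, by simp⟩)
    simp
  · rw [huniq C hC, ← hcφ]
    exact hC₀norm
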